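/- All structures are countable. A \emph{band} is a semigroup $B$ with $e^2=e$ for all $e\in B$; a \emph{semilattice} is a commutative band. Green's relation $\mathcal D$ on $B$ ($e\,\mathcal D\,f$ iff $efe=e$ and $fef=f$) is a congruence, and $Y(B)=B/\mathcal D$ is a semilattice, the \emph{structure semilattice} of $B$; write $[e]$ for the $\mathcal D$-class of $e$. The band $B$ is \emph{linearly ordered} if $Y(B)$ is a chain under its natural order ($\alpha\le\beta$ iff $\alpha\beta=\beta\alpha=\alpha$). A band $B$ is \emph{homogeneous} if every isomorphism between finite subbands of $B$ extends to an automorphism of $B$. It is \emph{structure-homogeneous} if it is homogeneous and, moreover, for every isomorphism $\theta:A_1\to A_2$ between finite subbands of $B$ and every automorphism $\hat\pi$ of $Y(B)$ that extends the induced isomorphism $[a]\mapsto[a\theta]$ $(a\in A_1)$, there is an automorphism $\hat\theta$ of $B$ that extends $\theta$ and induces $\hat\pi$, i.e. $[b]\hat\pi=[b\hat\theta]$ for all $b\in B$. For $n,m\in\{1,2,3,\dots\}\cup\{\aleph_0\}$ let $B_{n,m}$ be the rectangular band on $I\times J$ with $|I|=n$, $|J|=m$ and $(i,j)(k,\ell)=(i,\ell)$.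 \textbf{Theorem.} A (countable) band is structure-homogeneous if and only if it is isomorphic to a homogeneous linearly ordered band or to $Y\times B_{n,m}$ for some homogeneous semilattice $Y$ and some $n,m\in\{1,2,3,\dots\}\cup\{\aleph_0\}$. -/

import Mathlib

universe u

/-- A band: a semigroup in which every element is idempotent. -/
class Band (B : Type u) extends Semigroup B where
  mul_self : ∀ e : B, e * e = e

namespace Band

/-- Every subsemigroup of a band is a band. -/
instance subband {B : Type u} [Band B] (A : Subsemigroup B) : Band A where
  mul_self e := Subtype.ext (mul_self (e : B))

/-- A semilattice is a commutative band. -/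
def IsSemilattice (Y : Type u) [Band Y] : Prop :=
  ∀ a b : Y, a * b = b * a

/-- The natural order of a band: `e ≤ f` iff `ef = fe = e`. -/
def NatLE {B : Type u} [Band B] (e f : B) : Prop :=
  e * f = e ∧ f * e = e

/-- Green's relation `𝒟` on a band: `e 𝒟 f` iff `efe = e` and `fef = f`. -/
def DRel {B : Type u} [Band B] (e f : B) : Prop :=
  e * f * e = e ∧ f * e * f = f

section Congruence

variable {B : Type u} [Band B]

theorem sandwich {e f x y : B} (h : e = x * f * y) : e * f * e = e := by
  have key : ∀ d c : B, d * f = d → f * c = c → d * c * f * (d * c) = d * c := by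
    intro d c hd hc
    have h1 : d * (f * d) = d := by rw [← mul_assoc, hd, mul_self]
    have h2 : c * f * c = c := by rw [mul_assoc, hc, mul_self]
    calc d * c * f * (d * c)
        = (d * (f * d)) * c * f * (d * (c * f * c)) := by rw [h1, h2]
      _ = d * ((f * d) * (c * f) * ((d * c) * f)) * c := by simp only [mul_assoc]
      _ = d * ((f * d) * (c * f) * ((d * f * c) * f)) * c := by rw [hd]
      _ = d * (((f * d) * (c * f)) * (f * d * c * f)) * c := by
          have : c * f * (d * f * c * f) = c * f * (f * d * c * f) := by
            rw [hd, show c * f * (f * d * c * f) = c * (f * f) * (d * c * f) by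
              simp only [mul_assoc], mul_self]
          rw [mul_assoc (f * d), this, ← mul_assoc (f * d)]
      _ = d * (((f * d) * (c * f)) * ((f * d) * (c * f))) * c := by simp only [mul_assoc]
      _ = (d * (f * d)) * (c * f * c) := by rw [mul_self]; simp only [mul_assoc]
      _ = d * c := by rw [h1, h2]
  have hd : x * f * f = x * f := by rw [mul_assoc, mul_self]
  have hc : f * (f * y) = f * y := by rw [← mul_assoc, mul_self]
  have he : e = (x * f) * (f * y) := by
    rw [← mul_assoc, hd, h]
  rw [he]
  exact key _ _ hd hc

theorem sandwich_trans {e f g : B} (h₁ : e * f * e = e) (h₂ : f * g * f = f) :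
    e * g * e = e := by
  refine sandwich (x := e * f) (y := f * e) ?_
  calc e = e * (f * g * f) * e := by rw [h₂, h₁]
    _ = _ := by simp only [mul_assoc]

theorem sandwich_mul {e e' g g' : B} (h₁ : e * e' * e = e) (h₂ : g * g' * g = g) :
    e * g * (e' * g') * (e * g) = e * g := by
  have ha : e * g * e' * (e * g) = e * g := by
    refine sandwich (x := e) (y := e * g) ?_
    rw [← mul_assoc, h₁]
  have hb : e * g * g' * (e * g) = e * g := by
    refine sandwich (x := e * g) (y := g) ?_
    rw [mul_assoc e g g', mul_assoc e (g * g') g, h₂]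
  generalize e * g = h at ha hb
  refine sandwich (x := h * g' * h) (y := h * e' * h) ?_
  have hs := mul_self (g' * h * e')
  calc h = (h * g' * h) * (h * e' * h) := by rw [ha, hb, mul_self]
    _ = h * (g' * (h * h) * e') * h := by simp only [mul_assoc]
    _ = h * ((g' * h * e') * (g' * h * e')) * h := by rw [hs, mul_self h]
    _ = h * g' * h * (e' * g') * (h * e' * h) := by simp only [mul_assoc]

end Congruence

/-- `𝒟` is a congruence on every band. -/
def dCon (B : Type u) [Band B] : Con B where
  r := DRel
  iseqv :=
    { refl := fun e => by simp [DRel, mul_self]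
      symm := fun h => ⟨h.2, h.1⟩
      trans := fun h k => ⟨sandwich_trans h.1 k.1, sandwich_trans k.2 h.2⟩ }
  mul' := fun h k => ⟨sandwich_mul h.1 k.1, sandwich_mul h.2 k.2⟩

/-- The structure semilattice `Y = B/𝒟` of a band `B`. -/
abbrev StructureSemilattice (B : Type u) [Band B] : Type u := (dCon B).Quotient

/-- The index `α ∈ Y` of the `𝒟`-class `B_α` containing `e`. -/
def cls {B : Type u} [Band B] (e : B) : StructureSemilattice B := (e : (dCon B).Quotient)

instance structureSemilatticeBand (B : Type u) [Band B] : Band (StructureSemilattice B) where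
  mul_self := by
    rintro ⟨e⟩
    exact congrArg (cls (B := B)) (mul_self e)

theorem cls_mul {B : Type u} [Band B] (e f : B) : cls (e * f) = cls e * cls f := rfl

theorem cls_eq_iff {B : Type u} [Band B] (e f : B) : cls e = cls f ↔ DRel e f :=
  (dCon B).eq

theorem structureSemilattice_isSemilattice (B : Type u) [Band B] :
    IsSemilattice (StructureSemilattice B) := by
  rintro ⟨e⟩ ⟨f⟩
  have key : ∀ e f : B, e * f * (f * e) * (e * f) = e * f := by
    intro e f
    rw [show e * f * (f * e) * (e * f) = e * (f * f) * (e * e) * f by simp only [mul_assoc],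
      mul_self, mul_self, mul_assoc (e * f), mul_self]
  exact (cls_eq_iff (e * f) (f * e)).2 ⟨key e f, key f e⟩

/-- A band is linearly ordered if its structure semilattice is a chain. -/
def IsLinearlyOrdered (B : Type u) [Band B] : Prop :=
  ∀ α β : StructureSemilattice B, NatLE α β ∨ NatLE β α

/-- A band is homogeneous if every isomorphism between finite subbands extends to an
automorphism. (Allowing the empty subband changes nothing here.) -/
def IsHomogeneous (B : Type u) [Band B] : Prop :=
  ∀ A₁ A₂ : Subsemigroup B, Finite A₁ → Finite A₂ → ∀ θ : A₁ ≃* A₂,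
    ∃ Θ : B ≃* B, ∀ a : A₁, Θ a = θ a

/-- The automorphism `ρ` of the structure semilattice `Y` of `B` extends the isomorphism
`supp A₁ → supp A₂`, `[a] ↦ [θ a]`, induced by `θ : A₁ ≃* A₂`. -/
def ExtendsInduced {B : Type u} [Band B] {A₁ A₂ : Subsemigroup B} (θ : A₁ ≃* A₂)
    (ρ : StructureSemilattice B ≃* StructureSemilattice B) : Prop :=
  ∀ a : A₁, ρ (cls (a : B)) = cls (θ a : B)

/-- `ρ` is the automorphism of the structure semilattice induced by the automorphism `Θ`. -/
def Induces {B : Type u} [Band B] (Θ : B ≃* B)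
    (ρ : StructureSemilattice B ≃* StructureSemilattice B) : Prop :=
  ∀ b : B, ρ (cls b) = cls (Θ b)

/-- A band is structure-homogeneous if it is homogeneous and, for every isomorphism `θ` between
finite subbands, each automorphism of the structure semilattice that extends the isomorphism
induced by `θ` is induced by some automorphism of the band that extends `θ`. -/
def IsStructureHomogeneous (B : Type u) [Band B] : Prop :=
  IsHomogeneous B ∧
  ∀ A₁ A₂ : Subsemigroup B, Finite A₁ → Finite A₂ → ∀ θ : A₁ ≃* A₂,
    ∀ ρ : StructureSemilattice B ≃* StructureSemilattice B, ExtendsInduced θ ρ →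
      ∃ Θ : B ≃* B, (∀ a : A₁, Θ a = θ a) ∧ Induces Θ ρ

/-- The rectangular band on `I × J`, with `(i, j)(k, l) = (i, l)`. -/
@[ext] structure Rect (I J : Type u) where
  row : I
  col : J

instance rectBand (I J : Type u) : Band (Rect I J) where
  mul a b := ⟨a.row, b.col⟩
  mul_assoc _ _ _ := rfl
  mul_self _ := rfl

/-- A set with `n` elements, `n ∈ ℕ ∪ {ℵ₀}`. -/
def Index : ℕ∞ → Type
  | none => ℕ
  | some n => Fin n

/-- The rectangular band `B_{n,m}` with `n` `ℛ`-classes (indexed by the first coordinate) and `m`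
`ℒ`-classes (indexed by the second one). -/
abbrev RectNM (n m : ℕ∞) : Type := Rect (Index n) (Index m)

end Band

/-!
The relation `Below e f :⇔ efe = e` is a preorder whose classes are the `𝒟`-classes, so the
structure semilattice can be handled through elements. A statement about columns is the statement
about rows in the opposite band, and homogeneity is used in the form that two finite families with
the same multiplication table are conjugate under an automorphism
(`IsHomogeneous.exists_mulEquiv`).

*Homogeneous linearly ordered bands are structure-homogeneous.* An element `u` acts on the left of
every lower `𝒟`-class by an idempotent map on its rows. Since automorphisms preserve the order of
the chain of `𝒟`-classes, an automorphism swapping two configurations cannot enlarge a set of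
classes attached to one of them to the set attached to the other. Such swap arguments show that
every element has elements above it in every higher class (`exists_dRel_above`), and that the
actions are either all trivial, or all constant on rows with different rows acting differently
(`leftTrivial_or_leftConstant`). In the trivial case the rows of the various classes are
independent of each other, in the constant case they are identified throughout the band. Either way
a finite partial bijection of rows extends to a permutation over any prescribed automorphism of the
chain (`exists_rowMatching`). An element is determined by its class, row and column, and so the
permutations of rows and columns assemble to an automorphism (`exists_mulEquiv_of_matchings`).

*Products.* In `Y × B_{n,m}` rows and columns are global and the same assembly applies.

*Structure-homogeneous bands that are not linearly ordered are products.* Here any isomorphism of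
finite subbands that preserves each class extends to an automorphism preserving each class. If two
different elements of a class were below a common `u`, then for incomparable `a, b` they could be
moved below both `a` and an element `v` in the class of `b`; but then both equal `ava`
(`under_unique`). If two elements of a class had a common lower element in another class, all pairs
of their kind would, and no such pair could exist in the lower class (`eq_of_under`). So comparable
classes are in bijection via the natural order (`IsUniform`), the band is normal, and the relation
`fef = ef` is an equivalence identifying rows of different classes; together with its dual it
splits the band as a direct product (`IsUniform.exists_mulEquiv`).
-/

namespace Band

/-! ### Words in a band -/

section Basic

variable {B : Type u} [Band B]

instance : Std.IdempotentOp (α := B) (· * ·) := ⟨mul_self⟩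

instance : Std.Commutative (α := StructureSemilattice B) (· * ·) :=
  ⟨structureSemilattice_isSemilattice B⟩

/-- The opposite of a band. Passing to it exchanges left and right, which reduces every statement
about columns to one about rows. -/
instance oppositeBand : Band Bᵐᵒᵖ where
  mul_self e := MulOpposite.unop_injective (mul_self e.unop)

/-- The preorder on `B` whose classes are the `𝒟`-classes: the class of `e` lies below the class
of `f` in the structure semilattice. -/
def Below (e f : B) : Prop := e * f * e = e

/-- The preorder is the natural order of the structure semilattice; this turns questions about
`𝒟`-classes of words into semilattice identities. -/
theorem below_iff {e f : B} : Below e f ↔ cls e * cls f = cls e := by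
  rw [← cls_mul, cls_eq_iff]
  constructor
  · intro h
    have h' : e * f * e = e := h
    constructor <;> grind [mul_self (e * f)]
  · rintro ⟨h1, h2⟩
    have h' : e * f * e = e := by grind
    exact h'

theorem dRel_iff {e f : B} : DRel e f ↔ Below e f ∧ Below f e := Iff.rfl

theorem Below.refl (e : B) : Below e e := by simp [Below, mul_self]

theorem Below.trans {e f g : B} (h : Below e f) (k : Below f g) : Below e g := by
  rw [below_iff] at *; grind

theorem DRel.refl (e : B) : DRel e e := ⟨Below.refl e, Below.refl e⟩

theorem DRel.symm {e f : B} (h : DRel e f) : DRel f e := ⟨h.2, h.1⟩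

theorem DRel.trans {e f g : B} (h : DRel e f) (k : DRel f g) : DRel e g :=
  ⟨Below.trans h.1 k.1, Below.trans k.2 h.2⟩

theorem below_op {e f : Bᵐᵒᵖ} : Below e f ↔ Below e.unop f.unop := by
  unfold Below
  rw [← MulOpposite.unop_inj]
  simp [mul_assoc]

theorem dRel_op {e f : Bᵐᵒᵖ} : DRel e f ↔ DRel e.unop f.unop := by
  rw [dRel_iff, dRel_iff, below_op, below_op]

theorem Below.map (Φ : B ≃* B) {e f : B} (h : Below e f) : Below (Φ e) (Φ f) := by
  have h' : e * f * e = e := h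
  change Φ e * Φ f * Φ e = Φ e
  rw [← map_mul, ← map_mul, h']

theorem DRel.map (Φ : B ≃* B) {e f : B} (h : DRel e f) : DRel (Φ e) (Φ f) :=
  ⟨Below.map Φ h.1, Below.map Φ h.2⟩

theorem DRel.below {e f : B} (h : DRel e f) : Below e f := h.1

/-- Each `𝒟`-class is a rectangular band. -/
theorem DRel.rect {e f g : B} (h : DRel e f) (k : DRel f g) : e * f * g = e * g := by
  have h1 : e * f * e = e := h.1
  have h2 : g * f * g = g := k.2
  have h3 : e * g * e = e := (h.trans k).1
  have h4 : g * e * g = g := (h.trans k).2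
  have hd : DRel (e * f * g) (e * g) := by
    rw [← cls_eq_iff] at *
    simp only [cls_mul] at *
    grind
  have h5 : e * f * g * (e * g) * (e * f * g) = e * f * g := hd.1
  have h6 : e * g * (e * f * g) * (e * g) = e * g := hd.2
  grind

theorem dRel_mul_left {e f : B} (h : Below e f) : DRel (e * f) e := by
  rw [below_iff] at h
  rw [← cls_eq_iff, cls_mul, h]

theorem dRel_mul_right {e f : B} (h : Below e f) : DRel (f * e) e := by
  rw [below_iff] at h
  rw [← cls_eq_iff, cls_mul]
  grind

theorem below_total_iff :
    IsLinearlyOrdered B ↔ ∀ e f : B, Below e f ∨ Below f e := by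
  have key : ∀ e f : B, NatLE (cls e) (cls f) ↔ Below e f := by
    intro e f
    rw [below_iff]
    exact ⟨fun h => h.1, fun h => ⟨h, by grind⟩⟩
  constructor
  · intro h e f
    rw [← key, ← key]
    exact h _ _
  · rintro h ⟨e⟩ ⟨f⟩
    have := h e f
    rw [← key, ← key] at this
    exact this

end Basic

/-! ### Homogeneity in terms of multiplication tables -/

/-- The family `f` is injective and multiplies according to the table `m`, so that its range is a
subband with multiplication `m`. -/
structure Realizes {ι : Type*} {B : Type u} [Band B] (m : ι → ι → ι) (f : ι → B) : Prop where
  inj : Function.Injective f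
  mul : ∀ i j, f i * f j = f (m i j)

namespace Realizes

variable {ι : Type*} {B : Type u} [Band B] {m : ι → ι → ι} {f : ι → B}

theorem map (h : Realizes m f) (Φ : B ≃* B) : Realizes m (fun i => Φ (f i)) :=
  ⟨Φ.injective.comp h.inj, fun i j => by rw [← map_mul, h.mul]⟩

theorem unop {f : ι → Bᵐᵒᵖ} (h : Realizes m f) :
    Realizes (fun i j => m j i) (fun i => (f i).unop) :=
  ⟨MulOpposite.unop_injective.comp h.inj,
    fun i j => by rw [← MulOpposite.unop_mul, h.mul]⟩

theorem comp {κ : Type*} (h : Realizes m f) (e : κ ≃ ι) :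
    Realizes (fun i j => e.symm (m (e i) (e j))) (fun i => f (e i)) :=
  ⟨h.inj.comp e.injective, fun i j => by simp [h.mul]⟩

/-- The subband enumerated by `f`. -/
def range (h : Realizes m f) : Subsemigroup B where
  carrier := Set.range f
  mul_mem' := by
    rintro _ _ ⟨i, rfl⟩ ⟨j, rfl⟩
    exact ⟨m i j, (h.mul i j).symm⟩

/-- The enumeration of the subband by the indices. -/
noncomputable def equivRange (h : Realizes m f) : ι ≃ h.range :=
  Equiv.ofBijective (fun i => ⟨f i, i, rfl⟩)
    ⟨fun _ _ hij => h.inj (congrArg Subtype.val hij), by rintro ⟨_, i, rfl⟩; exact ⟨i, rfl⟩⟩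

theorem coe_equivRange (h : Realizes m f) (i : ι) : (h.equivRange i : B) = f i := rfl

theorem equivRange_mul (h : Realizes m f) (i j : ι) :
    h.equivRange i * h.equivRange j = h.equivRange (m i j) :=
  Subtype.ext (h.mul i j)

/-- Two families with the same multiplication table enumerate isomorphic subbands. -/
noncomputable def iso {g : ι → B} (hf : Realizes m f) (hg : Realizes m g) :
    hf.range ≃* hg.range where
  toEquiv := hf.equivRange.symm.trans hg.equivRange
  map_mul' a b := by
    obtain ⟨i, rfl⟩ := hf.equivRange.surjective a
    obtain ⟨j, rfl⟩ := hf.equivRange.surjective b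
    simp [equivRange_mul]

theorem iso_apply {g : ι → B} (hf : Realizes m f) (hg : Realizes m g) (i : ι) :
    hf.iso hg (hf.equivRange i) = hg.equivRange i := by
  simp [iso]

theorem of_subsemigroup (A : Subsemigroup B) :
    Realizes (fun i j : A => i * j) (fun i : A => (i : B)) :=
  ⟨Subtype.val_injective, fun _ _ => rfl⟩

theorem of_mulEquiv {A₁ A₂ : Subsemigroup B} (θ : A₁ ≃* A₂) :
    Realizes (fun i j : A₁ => i * j) (fun i : A₁ => (θ i : B)) :=
  ⟨Subtype.val_injective.comp θ.injective, fun i j => by rw [map_mul]; rfl⟩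

end Realizes

theorem IsHomogeneous.exists_mulEquiv {B : Type u} [Band B] (hB : IsHomogeneous B) {ι : Type*}
    [Finite ι] {m : ι → ι → ι} {f g : ι → B} (hf : Realizes m f) (hg : Realizes m g) :
    ∃ Φ : B ≃* B, ∀ i, Φ (f i) = g i := by
  obtain ⟨Φ, hΦ⟩ := hB hf.range hg.range (Set.finite_range f) (Set.finite_range g) (hf.iso hg)
  refine ⟨Φ, fun i => ?_⟩
  have h := hΦ (hf.equivRange i)
  rwa [hf.iso_apply hg, hf.coe_equivRange, hg.coe_equivRange] at h

theorem IsHomogeneous.of_realizes {B : Type u} [Band B]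
    (h : ∀ (n : ℕ) (m : Fin n → Fin n → Fin n) (f g : Fin n → B), Realizes m f → Realizes m g →
      ∃ Φ : B ≃* B, ∀ i, Φ (f i) = g i) : IsHomogeneous B := by
  intro A₁ A₂ _ _ θ
  obtain ⟨n, ⟨e⟩⟩ := Finite.exists_equiv_fin A₁
  obtain ⟨Φ, hΦ⟩ := h n _ _ _ ((Realizes.of_subsemigroup A₁).comp e.symm)
    ((Realizes.of_mulEquiv θ).comp e.symm)
  exact ⟨Φ, fun a => by simpa using hΦ (e a)⟩

theorem IsHomogeneous.op {B : Type u} [Band B] (hB : IsHomogeneous B) : IsHomogeneous Bᵐᵒᵖ := by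
  refine IsHomogeneous.of_realizes fun n m f g hf hg => ?_
  obtain ⟨Φ, hΦ⟩ := hB.exists_mulEquiv hf.unop hg.unop
  exact ⟨MulEquiv.op Φ, fun i => MulOpposite.unop_injective (hΦ i)⟩

theorem IsHomogeneous.congr {B C : Type u} [Band B] [Band C] (e : B ≃* C)
    (hC : IsHomogeneous C) : IsHomogeneous B := by
  refine IsHomogeneous.of_realizes fun n m f g hf hg => ?_
  obtain ⟨Φ, hΦ⟩ := hC.exists_mulEquiv (m := m) (f := fun i => e (f i)) (g := fun i => e (g i))
    ⟨e.injective.comp hf.inj, fun i j => by rw [← map_mul, hf.mul]⟩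
    ⟨e.injective.comp hg.inj, fun i j => by rw [← map_mul, hg.mul]⟩
  exact ⟨(e.trans Φ).trans e.symm, fun i => by simp [hΦ]⟩

theorem injective_pair {α : Type*} {x y : α} (h : x ≠ y) : Function.Injective ![x, y] := by
  intro i j hij
  fin_cases i <;> fin_cases j <;> simp_all [h.symm]

section LeftZero

variable {B : Type u} [Band B]

/-- The elements `x` and `y` are distinct and lie in the same `ℒ`-class, so that `{x, y}` is a
left-zero band. -/
structure LeftZero (x y : B) : Prop where
  ne : x ≠ y
  left : x * y = x
  right : y * x = y

theorem LeftZero.symm {x y : B} (h : LeftZero x y) : LeftZero y x :=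
  ⟨h.ne.symm, h.right, h.left⟩

theorem LeftZero.dRel {x y : B} (h : LeftZero x y) : DRel x y :=
  ⟨by rw [h.left, mul_self], by rw [h.right, mul_self]⟩

theorem LeftZero.map {x y : B} (h : LeftZero x y) (Φ : B ≃* B) : LeftZero (Φ x) (Φ y) :=
  ⟨fun hh => h.ne (Φ.injective hh), by rw [← map_mul, h.left], by rw [← map_mul, h.right]⟩

theorem LeftZero.trans {x y z : B} (h : LeftZero x y) (k : LeftZero y z) (hne : x ≠ z) :
    LeftZero x z :=
  ⟨hne, by rw [← h.left, mul_assoc, k.left], by rw [← k.right, mul_assoc, h.right]⟩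

/-- Left multiplication by an element of a higher class preserves `ℒ`-classes. -/
theorem leftZero_mul {u e : B} (h : Below e u) (hne : u * e ≠ e) : LeftZero e (u * e) := by
  have h' : e * u * e = e := h
  exact ⟨hne.symm, by grind, by grind⟩

theorem realizes_of_rightZero {x y : B} (hne : x ≠ y) (h₁ : x * y = y) (h₂ : y * x = x) :
    Realizes (fun _ j => j) ![x, y] :=
  ⟨injective_pair hne, fun i j => by
    fin_cases i <;> fin_cases j <;> simp [h₁, h₂, mul_self]⟩

theorem LeftZero.realizes {x y : B} (h : LeftZero x y) :
    Realizes (fun i _ => i) ![x, y] :=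
  ⟨injective_pair h.ne, fun i j => by
    fin_cases i <;> fin_cases j <;> simp [h.left, h.right, mul_self]⟩

theorem LeftZero.realizes₃ {x y z : B} (h : LeftZero x y) (k : LeftZero y z) (hne : x ≠ z) :
    Realizes (fun i _ => i) ![x, y, z] := by
  have l := h.trans k hne
  constructor
  · intro i j hij
    fin_cases i <;> fin_cases j <;> simp_all [h.ne, h.ne.symm, k.ne, k.ne.symm, l.ne, l.ne.symm]
  · intro i j
    fin_cases i <;> fin_cases j <;>
      simp [h.left, h.right, k.left, k.right, l.left, l.right, mul_self]

/-- A two-element chain `x < u` in the natural order. -/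
structure Chain (x u : B) : Prop where
  ne : x ≠ u
  left : u * x = x
  right : x * u = x

theorem Chain.realizes {x u : B} (h : Chain x u) : Realizes min ![x, u] :=
  ⟨injective_pair h.ne, fun i j => by
    fin_cases i <;> fin_cases j <;> simp [h.left, h.right, mul_self]⟩

theorem Chain.map {x u : B} (h : Chain x u) (Φ : B ≃* B) : Chain (Φ x) (Φ u) :=
  ⟨fun hh => h.ne (Φ.injective hh), by rw [← map_mul, h.left], by rw [← map_mul, h.right]⟩

theorem Chain.below {x u : B} (h : Chain x u) : Below x u := by
  rw [Below, h.right, mul_self]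

/-- Below every `u` there is an element of each lower `𝒟`-class. -/
theorem chain_of_below {x u : B} (h : Below x u) (h' : ¬ Below u x) :
    Chain (u * x * u) u ∧ DRel (u * x * u) x := by
  have hd : DRel (u * x * u) x := by
    rw [below_iff] at h
    rw [← cls_eq_iff, cls_mul, cls_mul]
    grind
  refine ⟨⟨fun hh => h' ?_, by grind, by grind⟩, hd⟩
  exact hh


end LeftZero

namespace IsHomogeneous

variable {B : Type u} [Band B]

theorem exists_map_eq (hB : IsHomogeneous B) (x y : B) : ∃ Φ : B ≃* B, Φ x = y := by
  obtain ⟨Φ, hΦ⟩ := hB.exists_mulEquiv (ι := Fin 1) (m := fun i _ => i) (f := fun _ => x)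
    (g := fun _ => y)
    ⟨fun _ _ _ => Subsingleton.elim _ _, fun _ _ => mul_self _⟩
    ⟨fun _ _ _ => Subsingleton.elim _ _, fun _ _ => mul_self _⟩
  exact ⟨Φ, hΦ 0⟩

theorem exists_map_leftZero (hB : IsHomogeneous B) {x y x' y' : B} (h : LeftZero x y)
    (h' : LeftZero x' y') : ∃ Φ : B ≃* B, Φ x = x' ∧ Φ y = y' := by
  obtain ⟨Φ, hΦ⟩ := hB.exists_mulEquiv h.realizes h'.realizes
  exact ⟨Φ, by simpa using hΦ 0, by simpa using hΦ 1⟩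

theorem exists_map_leftZero₃ (hB : IsHomogeneous B) {x y z x' y' z' : B} (h : LeftZero x y)
    (k : LeftZero y z) (hne : x ≠ z) (h' : LeftZero x' y') (k' : LeftZero y' z')
    (hne' : x' ≠ z') : ∃ Φ : B ≃* B, Φ x = x' ∧ Φ y = y' ∧ Φ z = z' := by
  obtain ⟨Φ, hΦ⟩ := hB.exists_mulEquiv (h.realizes₃ k hne) (h'.realizes₃ k' hne')
  exact ⟨Φ, by simpa using hΦ 0, by simpa using hΦ 1, by simpa using hΦ 2⟩

theorem exists_map_chain (hB : IsHomogeneous B) {x u x' u' : B} (h : Chain x u)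
    (h' : Chain x' u') : ∃ Φ : B ≃* B, Φ x = x' ∧ Φ u = u' := by
  obtain ⟨Φ, hΦ⟩ := hB.exists_mulEquiv h.realizes h'.realizes
  exact ⟨Φ, by simpa using hΦ 0, by simpa using hΦ 1⟩

end IsHomogeneous

/-! ### Homogeneous linearly ordered bands: local structure -/

section Linear

variable {B : Type u} [Band B]

/-- Any two elements are comparable in the preorder `Below`; by `below_total_iff` this says that the
band is linearly ordered. -/
def BelowTotal (B : Type u) [Band B] : Prop := ∀ e f : B, Below e f ∨ Below f e

theorem BelowTotal.op (hl : BelowTotal B) : BelowTotal Bᵐᵒᵖ := fun e f => by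
  rw [below_op, below_op]
  exact hl _ _

/-- One-sided form of `exists_dRel_above`. If `v` moves `x` to `y = vx` and no element of its class
fixes `x`, an automorphism swapping `x` and `y` sends `v` to some `u` with `uy = x`; whichever of
`uv`, `vu` lies in the lower of the two classes fixes `x`, respectively `y`, a contradiction. -/
theorem exists_dRel_mul_eq (hB : IsHomogeneous B) (hl : BelowTotal B) {x v : B} (h : Below x v) :
    ∃ u, DRel u v ∧ u * x = x := by
  by_contra! hno
  have hxy := leftZero_mul h (hno v (DRel.refl v))
  obtain ⟨Φ, hx, hy⟩ := hB.exists_map_leftZero hxy hxy.symm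
  have hu : Φ v * (v * x) = x := by rw [← hx, ← map_mul, hy]
  rcases hl v (Φ v) with hv | hv
  · exact hno _ (dRel_mul_right hv) (by rw [mul_assoc, hu])
  · refine hno (Φ.symm (v * Φ v)) (by simpa using (dRel_mul_right hv).map Φ.symm) ?_
    apply Φ.injective
    rw [map_mul, hx, MulEquiv.apply_symm_apply, mul_assoc, hu]

/-- In a homogeneous linearly ordered band, each element has elements above it, in the natural
order, in every higher `𝒟`-class. -/
theorem exists_dRel_above (hB : IsHomogeneous B) (hl : BelowTotal B) {x v : B} (h : Below x v) :
    ∃ u, DRel u v ∧ u * x = x ∧ x * u = x := by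
  by_contra! hno
  obtain ⟨w, hwv, hwx⟩ := exists_dRel_mul_eq hB hl h
  have hxw : x * w * x = x := Below.trans h hwv.2
  have hne : x ≠ x * w := fun hh => hno w hwv hwx hh.symm
  have h₁ : x * (x * w) = x * w := by grind
  have h₂ : x * w * x = x := hxw
  obtain ⟨Φ, hΦ⟩ := hB.exists_mulEquiv (realizes_of_rightZero hne h₁ h₂)
    (realizes_of_rightZero hne.symm h₂ h₁)
  have hx : Φ x = x * w := by simpa using hΦ 0
  have hy : Φ (x * w) = x := by simpa using hΦ 1
  obtain ⟨y, hyd⟩ : ∃ y, y = x * w := ⟨_, rfl⟩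
  rw [← hyd] at hx hy h₁ h₂
  obtain ⟨u, hu⟩ : ∃ u, u = Φ w := ⟨_, rfl⟩
  have huy : u * y = y := by rw [hu, ← hx, ← map_mul, hwx]
  have hyu : y * u = x := by rw [hu, ← hx, ← map_mul, ← hyd, hy]
  rcases hl w u with hwu | hwu
  · exact hno (w * u) ((dRel_mul_left hwu).trans hwv) (by grind) (by grind)
  · have hd : DRel (Φ.symm (u * w)) v := by
      refine DRel.trans ?_ hwv
      have := (dRel_mul_left hwu).map Φ.symm
      rwa [hu, MulEquiv.symm_apply_apply, ← hu] at this
    refine hno _ hd ?_ ?_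
    · apply Φ.injective
      rw [map_mul, hx, MulEquiv.apply_symm_apply]
      grind
    · apply Φ.injective
      rw [map_mul, hx, MulEquiv.apply_symm_apply]
      grind

/-- Left multiplication by an element does not act on a left-zero triple with two distinct fixed
points `v₁` and `v₃` and a further point `v₂` moved to `v₃`. By `NoMixedAction.mul_eq_mul` it then
acts on each lower `𝒟`-class either as the identity or constantly on rows. -/
def NoMixedAction (B : Type u) [Band B] : Prop :=
  ∀ u v₁ v₂ v₃ : B, LeftZero v₁ v₂ → LeftZero v₂ v₃ → v₁ ≠ v₃ →
    u * v₁ = v₁ → u * v₂ = v₃ → u * v₃ = v₃ → False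

/-- Suppose that `u` fixes `v₁` and moves `v₂` to a different `v₃`. Then an element `t` that has two
members of a left-zero triple as left units has the third one as well: moving the triple to
`v₁, v₂, v₃`, one gets `ut = u(v₁t) = t` and `ut = u(v₂t) = v₃t`. -/
theorem mul_eq_of_mixedAction (hB : IsHomogeneous B) {u v₁ v₂ v₃ : B} (h₁₂ : LeftZero v₁ v₂)
    (h₂₃ : LeftZero v₂ v₃) (h₁₃ : v₁ ≠ v₃) (e₁ : u * v₁ = v₁) (e₂ : u * v₂ = v₃)
    {w₁ w₂ w₃ t : B} (k₁₂ : LeftZero w₁ w₂) (k₂₃ : LeftZero w₂ w₃) (k₁₃ : w₁ ≠ w₃)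
    (t₁ : w₁ * t = t) (t₂ : w₂ * t = t) : w₃ * t = t := by
  obtain ⟨Φ, hw₁, hw₂, hw₃⟩ := hB.exists_map_leftZero₃ k₁₂ k₂₃ k₁₃ h₁₂ h₂₃ h₁₃
  have s₁ : v₁ * Φ t = Φ t := by rw [← hw₁, ← map_mul, t₁]
  have s₂ : v₂ * Φ t = Φ t := by rw [← hw₂, ← map_mul, t₂]
  apply Φ.injective
  rw [map_mul, hw₃]
  grind

/-- If every element below `v` has the whole `ℒ`-class of `v` as left units, then all elements act
as the identity on lower classes: `ux = u(vx) = (uv)x = x` for some `v` above `x` in the class of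
`u`. -/
theorem mul_eq_self_of_not_single (hB : IsHomogeneous B) (hl : BelowTotal B)
    (hall : ∀ t v v' : B, Chain t v → LeftZero v v' → v' * t = t) {x u : B} (h : Below x u)
    (h' : ¬ Below u x) : u * x = x := by
  obtain ⟨v, hvu, hvx, hxv⟩ := exists_dRel_above hB hl h
  have hch : Chain x v := ⟨fun hh => h' (hh ▸ hvu.2), hvx, hxv⟩
  have hv : v * u * v = v := hvu.1
  by_cases hne : v = u * v
  · rw [← hvx, ← mul_assoc, ← hne]
  · have := hall x v (u * v) hch ⟨hne, by grind, by grind⟩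
    rwa [mul_assoc, hvx] at this

/-- Suppose that for `t < v` no other element of the `ℒ`-class of `v` is a left unit of `t`. If
`u` fixes two elements `x, y` of an `ℒ`-class in a lower `𝒟`-class, then the image `x'` of `x` under
a further element `w` of the `ℒ`-class of `u` has no common left unit with `x` in the class of `u`.
The classes containing common left units of a given pair form an up-set, so an automorphism
carrying `(x, y)` to `(x, x')` and back cannot exist. -/
theorem false_of_single (hB : IsHomogeneous B) (hl : BelowTotal B)
    (hs : ∀ t v v' : B, Chain t v → LeftZero v v' → v' * t ≠ t)
    {u x y : B} (hxy : LeftZero x y) (hxu : Below x u) (hux' : ¬ Below u x)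
    (ex : u * x = x) (ey : u * y = y) : False := by
  have hs' : ∀ {t v v' : B}, Below t v → ¬ Below v t → v * v' = v → v' * v = v' →
      v * t = t → v' * t = t → v' = v := by
    intro t v v' h h' k₁ k₂ e e'
    by_contra hne
    refine hs (v * t * v) v v' (chain_of_below h h').1 ⟨Ne.symm hne, k₁, k₂⟩ ?_
    rw [e, ← mul_assoc, e']
  obtain ⟨w, hw⟩ : ∃ w, LeftZero u w := by
    obtain ⟨Φ, hΦ⟩ := hB.exists_map_eq x u
    exact ⟨Φ y, hΦ ▸ hxy.map Φ⟩
  have hyu : Below y u := hxy.dRel.symm.below.trans hxu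
  have huy' : ¬ Below u y := fun h => hux' (h.trans hxy.dRel.2)
  have hxw : Below x w := hxu.trans hw.dRel.1
  have hwx : w * x ≠ x := fun h => hw.ne (hs' hxu hux' hw.left hw.right ex h).symm
  have hx' : LeftZero x (w * x) := leftZero_mul hxw hwx
  have hyx' : y ≠ w * x := by
    intro h
    refine hw.ne (hs' hyu huy' hw.left hw.right ey ?_).symm
    rw [h, ← mul_assoc, mul_self]
  let J : B → B → B → Prop := fun a b v => ∃ v', DRel v' v ∧ v' * a = a ∧ v' * b = b
  have hup : ∀ {a b v v' : B}, J a b v → Below v v' → J a b v' := by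
    rintro a b v v' ⟨p, hp, pa, pb⟩ hv
    obtain ⟨q, hq, qp, -⟩ := exists_dRel_above hB hl (hp.below.trans hv)
    exact ⟨q, hq, by rw [← pa, ← mul_assoc, qp], by rw [← pb, ← mul_assoc, qp]⟩
  have hJ : J x y u := ⟨u, DRel.refl u, ex, ey⟩
  have hJ' : ¬ J x (w * x) u := by
    rintro ⟨p, hp, px, pwx⟩
    have hup : u * p * u = u := hp.2
    have hwp : DRel p w := hp.trans hw.dRel
    have hwpw : w * p * w = w := hwp.2
    have huw := hw.left
    have hwu := hw.right
    have e₁ : p * u = u :=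
      hs' hxu hux' (by grind) (by grind) ex (by rw [mul_assoc, ex, px])
    have hwx'd : DRel (w * x) x := hx'.dRel.symm
    have e₂ : p * w = w := by
      refine hs' (t := w * x) (hwx'd.below.trans hxw) (fun h => hux' ?_) (by grind) (by grind)
        (by rw [← mul_assoc, mul_self])
        (by rw [mul_assoc, ← mul_assoc w, mul_self, pwx])
      exact hw.dRel.below.trans (h.trans hwx'd.below)
    have e₃ : w * p = p := by
      have : p * w * p = p := hwp.1
      grind
    exact hw.ne (by grind)
  obtain ⟨Φ, hΦx, hΦy, hΦx'⟩ := hB.exists_map_leftZero₃ (x := x) (y := y) (z := w * x)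
    (x' := x) (y' := w * x) (z' := y) hxy (hxy.symm.trans hx' hyx') hx'.ne hx'
    (hx'.symm.trans hxy hyx'.symm) hxy.ne
  have hJmap : ∀ {a b v : B}, J (Φ a) (Φ b) (Φ v) ↔ J a b v := by
    intro a b v
    constructor
    · rintro ⟨p, hp, pa, pb⟩
      refine ⟨Φ.symm p, by simpa using hp.map Φ.symm, ?_, ?_⟩ <;> apply Φ.injective <;>
        simpa
    · rintro ⟨p, hp, pa, pb⟩
      exact ⟨Φ p, hp.map Φ, by rw [← map_mul, pa], by rw [← map_mul, pb]⟩
  have h₁ : J x (w * x) (Φ u) := by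
    have := hJmap.2 hJ
    rwa [hΦx, hΦy] at this
  have h₂ : ¬ J x y (Φ u) := by
    have := mt hJmap.1 hJ'
    rwa [hΦx, hΦx'] at this
  rcases hl u (Φ u) with h | h
  · exact h₂ (hup hJ h)
  · exact hJ' (hup h₁ h)

/-- Given a mixed action, either some element has two distinct members of a higher `ℒ`-class as left
units, whence by `mul_eq_of_mixedAction` and homogeneity all actions are trivial, or none has,
which is excluded by `false_of_single`. -/
theorem noMixedAction (hB : IsHomogeneous B) (hl : BelowTotal B) : NoMixedAction B := by
  intro u v₁ v₂ v₃ h₁₂ h₂₃ h₁₃ e₁ e₂ e₃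
  have hb : ∀ {v : B}, DRel v₁ v → Below v u := by
    intro v hv
    refine hv.symm.below.trans ?_
    rw [Below, mul_assoc, e₁, mul_self]
  have hb' : ¬ Below u v₁ := by
    intro h
    have k₁ : DRel v₁ u := ⟨hb (DRel.refl _), h⟩
    -- in a rectangular band a left unit of `v₁` and of `v₃` forces equal rows
    have r : v₁ * u * v₃ = v₁ * v₃ := k₁.rect (k₁.symm.trans (h₁₂.dRel.trans h₂₃.dRel))
    have r' : v₃ * u * v₁ = v₃ * v₁ := (k₁.symm.trans (h₁₂.dRel.trans h₂₃.dRel)).symm.rect k₁.symm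
    have k₂ : u * v₁ * u = u := k₁.2
    have k₃ : u * v₃ * u = u := ((h₁₂.dRel.trans h₂₃.dRel).symm.trans k₁).2
    have l := h₁₂.trans h₂₃ h₁₃
    refine h₁₃ ?_
    have : v₁ * u = v₃ * u := by rw [← e₁, k₂, ← e₃, k₃]
    have a := l.left
    have b := l.right
    have c : v₁ * u * v₁ = v₁ := k₁.1
    grind
  by_cases hs : ∃ t v v' : B, Chain t v ∧ LeftZero v v' ∧ v' * t = t
  · obtain ⟨t, v, v', hc, hv, hvt⟩ := hs
    have hall : ∀ t v v' : B, Chain t v → LeftZero v v' → v' * t = t := by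
      intro t₁ w w' hc₁ hw
      obtain ⟨Φ, ht, hΦv⟩ := hB.exists_map_chain hc hc₁
      have hv' := hv.map Φ
      have hvt' : Φ v' * t₁ = t₁ := by rw [← ht, ← map_mul, hvt]
      rw [hΦv] at hv'
      by_cases hne : Φ v' = w'
      · rw [← hne, hvt']
      · exact mul_eq_of_mixedAction hB h₁₂ h₂₃ h₁₃ e₁ e₂ hv'
          (hv'.symm.trans hw hne) hw.ne hc₁.left hvt'
    have := mul_eq_self_of_not_single hB hl hall (hb h₁₂.dRel)
      (fun h => hb' (h.trans h₁₂.dRel.2))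
    exact h₂₃.ne (this.symm.trans e₂)
  · push Not at hs
    exact false_of_single hB hl hs (h₁₂.trans h₂₃ h₁₃) (hb (DRel.refl _)) hb' e₁ e₃

/-- Elements act on the left of all strictly lower `𝒟`-classes as the identity. -/
def LeftTrivial (B : Type u) [Band B] : Prop :=
  ∀ u x : B, Below x u → ¬ Below u x → u * x = x

/-- Left multiplication sends all of a lower `𝒟`-class into one row, and different rows of a
`𝒟`-class send it into different rows. -/
structure LeftConstant (B : Type u) [Band B] : Prop where
  mul_eq : ∀ {u x y : B}, Below x u → LeftZero x y → u * x = u * y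
  inj : ∀ {u v x : B}, LeftZero u v → Below x u → u * x ≠ v * x

/-- Within a single `𝒟`-class of lower level, an element acts as the identity or constantly. -/
theorem NoMixedAction.mul_eq_mul (hB : NoMixedAction B) {u x : B} (hxu : Below x u)
    (hne : u * x ≠ x) {y z : B} (hyx : DRel y x) (hyz : LeftZero y z) : u * y = u * z := by
  have hux : ∀ y, u * (u * y) = u * y := fun y => by rw [← mul_assoc, mul_self]
  have key : ∀ {y : B}, y * x = y → x * y = x → u * y = u * x := by
    intro y e₁ e₂
    by_contra hc
    have hx := leftZero_mul hxu hne
    have hxy : LeftZero x y := ⟨fun h => hc (by rw [h]), e₂, e₁⟩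
    have hyu : Below y u := hxy.dRel.symm.below.trans hxu
    have hyx : u * y ≠ x := fun h => hne (by rw [← h, hux])
    refine hB u (u * y) x (u * x) ?_ hx hc (hux y) rfl (hux x)
    by_cases h : u * y = y
    · rw [h]; exact hxy.symm
    · exact (hxy.trans (leftZero_mul hyu h) hyx.symm).symm
  have hzx : DRel z x := hyz.dRel.symm.trans hyx
  have hy : y * x * y = y := hyx.1
  have hy' : x * y * x = x := hyx.2
  have hz : z * x * z = z := hzx.1
  have hz' : x * z * x = x := hzx.2
  have k₁ := key (y := y * x) (by grind) (by grind)
  have k₂ := key (y := z * x) (by grind) (by grind)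
  have k₃ : x * y * z = x * z := hyx.symm.rect hyz.dRel
  have k₄ := hyz.left
  grind

/-- The type of action is the same for all pairs of `𝒟`-classes because any two chains `x < u` are
conjugate. In the constant case, if `u` and `v` agreed on a lower class, then comparing `v` with
any other `w` in their `ℒ`-class shows that the whole `ℒ`-class of `u` agrees there, so that its
image is a single row; but by `exists_dRel_mul_eq` every row occurs. -/
theorem leftTrivial_or_leftConstant (hB : IsHomogeneous B) (hl : BelowTotal B) :
    LeftTrivial B ∨ LeftConstant B := by
  by_cases ht : LeftTrivial B
  · exact Or.inl ht
  right
  have hN := noMixedAction hB hl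
  unfold LeftTrivial at ht
  push Not at ht
  obtain ⟨u₀, x₀, h₀, h₀', hne₀⟩ := ht
  have hmul : ∀ {u x y : B}, Below x u → LeftZero x y → u * x = u * y := by
    intro u x y hxu hxy
    by_cases hux : Below u x
    · have hd : DRel u x := ⟨hux, hxu⟩
      have := hd.rect hxy.symm.dRel.symm
      rw [← this, mul_assoc, hxy.left]
    · obtain ⟨hc, hd⟩ := chain_of_below hxu hux
      obtain ⟨hc₀, hd₀⟩ := chain_of_below h₀ h₀'
      obtain ⟨Φ, hΦ, hΦu⟩ := hB.exists_map_chain hc hc₀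
      have hx : DRel (Φ x) x₀ := (hd.symm.map Φ).trans (hΦ ▸ hd₀)
      have := hN.mul_eq_mul h₀ hne₀ hx (hxy.map Φ)
      rw [← hΦu, ← map_mul, ← map_mul] at this
      exact Φ.injective this
  have hpair := leftZero_mul h₀ hne₀
  refine ⟨hmul, ?_⟩
  intro u v x huv hxu hx
  have hxv : Below x v := hxu.trans huv.dRel.below
  -- the classes below `u` on which two elements agree form a down-set
  have hdown : ∀ {a b y z : B}, Below y a → Below y b → Below z y → a * y = b * y →
      a * z = b * z := by
    intro a b y z hya hyb hzy hab
    have key : ∀ {c : B}, Below z c → c * z = c * (y * z) := by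
      intro c hc
      by_cases hne : y * z = z
      · rw [hne]
      · exact hmul hc (leftZero_mul hzy hne)
    rw [key (hzy.trans hya), key (hzy.trans hyb), ← mul_assoc, ← mul_assoc, hab]
  have hall : ∀ {w : B}, w * u = w → u * w = u → w * x = u * x := by
    intro w k₁ k₂
    by_cases hwu : u = w
    · rw [hwu]
    by_cases hwv : v = w
    · rw [← hwv, hx]
    by_contra hc
    have huw : LeftZero u w := ⟨hwu, k₂, k₁⟩
    have hvw : LeftZero v w := huv.symm.trans huw hwv
    obtain ⟨Φ, hΦu, hΦv, hΦw⟩ := hB.exists_map_leftZero₃ huv hvw hwu huw hvw.symm huv.ne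
    have h₁ : u * Φ x = w * Φ x := by
      have := congrArg Φ hx
      rwa [map_mul, map_mul, hΦu, hΦv] at this
    have h₂ : u * Φ x ≠ v * Φ x := by
      intro h
      apply hc
      apply Φ.injective
      rw [map_mul, map_mul, hΦu, hΦw, h]
    have hΦx : Below (Φ x) u := hΦu ▸ hxu.map Φ
    rcases hl x (Φ x) with h | h
    · exact hc (hdown hΦx (hΦx.trans huw.dRel.below) h h₁).symm
    · exact h₂ (hdown hxu hxv h hx)
  obtain ⟨y, hxy⟩ : ∃ y, LeftZero x y := by
    obtain ⟨Φ, hΦ⟩ := hB.exists_map_eq u x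
    exact ⟨Φ v, hΦ ▸ huv.map Φ⟩
  have hfix : ∀ {z : B}, Below z u → (∀ w, w * u = w → u * w = u → w * z = u * z) →
      u * z = z := by
    intro z hz hall
    obtain ⟨a, ha, haz⟩ := exists_dRel_mul_eq hB hl hz
    have hau : u * a * u = u := ha.2
    have h₁ := hall (a * u) (by grind) (by grind)
    have h₂ : a * (u * z) = a * z := by
      by_cases hne : u * z = z
      · rw [hne]
      · exact (hmul (hz.trans ha.symm.below) (leftZero_mul hz hne)).symm
    rw [← h₁, mul_assoc, h₂, haz]
  have hux := hfix hxu fun w => hall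
  have hyu : Below y u := hxy.symm.dRel.below.trans hxu
  have huy := hfix hyu fun w k₁ k₂ => by
    have hd : DRel w u := ⟨by rw [k₁, mul_self], by rw [k₂, mul_self]⟩
    rw [← hmul hxu hxy, ← hmul (hxu.trans hd.symm.below) hxy, hall k₁ k₂]
  refine hxy.ne ?_
  rw [← hux, hmul hxu hxy, huy]

end Linear

/-! ### Assembling automorphisms from levels, rows and columns -/

section Assembly

variable {B : Type u} [Band B]

/-- A correspondence between the elements of `B` that depends only on `𝒟`-classes and induces an
automorphism of the structure semilattice. -/
structure LevelMatching (P : B → B → Prop) : Prop where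
  exists_right : ∀ e, ∃ e', P e e'
  exists_left : ∀ e', ∃ e, P e e'
  below_iff : ∀ {e e' f f'}, P e e' → P f f' → (Below e f ↔ Below e' f')
  of_dRel : ∀ {e e' e''}, P e e' → DRel e' e'' → P e e''
  mul : ∀ {e e' f f'}, P e e' → P f f' → P (e * f) (e' * f')

namespace LevelMatching

variable {P : B → B → Prop}

theorem dRel_iff (hP : LevelMatching P) {e e' f f' : B} (h : P e e') (k : P f f') :
    DRel e f ↔ DRel e' f' := by
  rw [Band.dRel_iff, Band.dRel_iff, hP.below_iff h k, hP.below_iff k h]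

theorem of_dRel_left (hP : LevelMatching P) {e e' f : B} (h : P e e') (k : DRel e f) : P f e' := by
  obtain ⟨f', hf⟩ := hP.exists_right f
  exact hP.of_dRel hf ((hP.dRel_iff h hf).1 k).symm

theorem op (hP : LevelMatching P) :
    LevelMatching (fun e e' : Bᵐᵒᵖ => P e.unop e'.unop) where
  exists_right e := (hP.exists_right e.unop).imp' MulOpposite.op fun _ h => h
  exists_left e := (hP.exists_left e.unop).imp' MulOpposite.op fun _ h => h
  below_iff h k := by rw [below_op, below_op]; exact hP.below_iff h k
  of_dRel h k := hP.of_dRel h (dRel_op.1 k)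
  mul h k := hP.mul k h

/-- An automorphism of a semilattice through which the order of the `𝒟`-classes factors gives a
level matching. -/
theorem of_mulEquiv {Z : Type*} [Mul Z] {c : B → Z} (hc : ∀ e f, c (e * f) = c e * c f)
    (hs : Function.Surjective c) (hb : ∀ e f, Below e f ↔ c e * c f = c e)
    (hcomm : ∀ a b : Z, a * b = b * a) (ψ : Z ≃* Z) :
    LevelMatching (fun e e' => ψ (c e) = c e') where
  exists_right e := (hs (ψ (c e))).imp fun _ h => h.symm
  exists_left e := (hs (ψ.symm (c e))).imp fun _ h => by rw [h, MulEquiv.apply_symm_apply]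
  below_iff h k := by rw [hb, hb, ← h, ← k, ← map_mul, ψ.injective.eq_iff]
  of_dRel {e e' e''} h k := by
    have h₁ := (hb _ _).1 k.below
    have h₂ := (hb _ _).1 k.symm.below
    rw [h, ← h₁, hcomm, h₂]
  mul h k := by rw [hc, hc, map_mul, h, k]

end LevelMatching

/-- A permutation `σ` of a set `R` of rows, compatible with a level matching `P`: the map
`row : B → R` separates the `ℛ`-classes of each `𝒟`-class, `σ` carries the rows occurring in a
`𝒟`-class to those occurring in the matching one, and it respects the row of a product. -/
structure RowMatching (P : B → B → Prop) {R : Type*} (row : B → R) (σ : R ≃ R) : Prop where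
  mul_eq : ∀ {e f}, DRel e f → row e = row f → e * f = f
  row_mul : ∀ {e f}, DRel e f → row (e * f) = row e
  exists_right : ∀ e, ∃ e', P e e' ∧ row e' = σ (row e)
  exists_left : ∀ e', ∃ e, P e e' ∧ row e' = σ (row e)
  mul : ∀ {e e' f f'}, P e e' → P f f' → row e' = σ (row e) → row f' = σ (row f) →
    row (e' * f') = σ (row (e * f))

/-- An element is determined by its level, row and column, so a row matching and a column matching
over the same level matching combine to an automorphism. -/
theorem exists_mulEquiv_of_matchings {P : B → B → Prop} (hP : LevelMatching P)
    {R : Type*} {row : B → R} {σ : R ≃ R} (hR : RowMatching P row σ)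
    {C : Type*} {col : Bᵐᵒᵖ → C} {τ : C ≃ C}
    (hC : RowMatching (fun e e' : Bᵐᵒᵖ => P e.unop e'.unop) col τ) :
    ∃ Θ : B ≃* B, (∀ e, P e (Θ e)) ∧ ∀ e e', P e e' → row e' = σ (row e) →
      col (.op e') = τ (col (.op e)) → Θ e = e' := by
  let M : B → B → Prop := fun e e' =>
    P e e' ∧ row e' = σ (row e) ∧ col (.op e') = τ (col (.op e))
  have hinj : ∀ {e f : B}, DRel e f → row e = row f → col (.op e) = col (.op f) → e = f := by
    intro e f hd hr hc
    have h₁ := hR.mul_eq hd hr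
    have h₂ : f * e = f :=
      MulOpposite.op_injective (hC.mul_eq (dRel_op.2 hd) hc)
    have h₃ : e * f * e = e := hd.1
    rw [h₁, h₂] at h₃
    exact h₃.symm
  have hfun : ∀ {e e' e''}, M e e' → M e e'' → e' = e'' := fun {e e' e''} h k =>
    hinj ((hP.dRel_iff h.1 k.1).1 (DRel.refl e)) (h.2.1.trans k.2.1.symm) (h.2.2.trans k.2.2.symm)
  have hfun' : ∀ {e e' e''}, M e e'' → M e' e'' → e = e' := fun {e e' e''} h k =>
    hinj ((hP.dRel_iff h.1 k.1).2 (DRel.refl e''))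
      (σ.injective (h.2.1.symm.trans k.2.1)) (τ.injective (h.2.2.symm.trans k.2.2))
  have hcm : ∀ {e f : B}, DRel e f → col (.op (e * f)) = col (.op f) := fun {e f} hd =>
    hC.row_mul (e := .op f) (f := .op e) (dRel_op.2 hd.symm)
  have hr : ∀ e, ∃ e', M e e' := by
    intro e
    obtain ⟨a, ha, ha'⟩ := hR.exists_right e
    obtain ⟨b, hb, hb'⟩ := hC.exists_right (.op e)
    have hd : DRel a b.unop := (hP.dRel_iff ha hb).1 (DRel.refl e)
    exact ⟨a * b.unop, hP.of_dRel ha (dRel_mul_left hd.below).symm,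
      by rw [hR.row_mul hd, ha'], by rw [hcm hd]; exact hb'⟩
  have hl : ∀ e', ∃ e, M e e' := by
    intro e'
    obtain ⟨a, ha, ha'⟩ := hR.exists_left e'
    obtain ⟨b, hb, hb'⟩ := hC.exists_left (.op e')
    have hd : DRel a b.unop := (hP.dRel_iff ha hb).2 (DRel.refl e')
    exact ⟨a * b.unop, hP.of_dRel_left ha (dRel_mul_left hd.below).symm,
      by rw [hR.row_mul hd, ha'], by rw [hcm hd]; exact hb'⟩
  choose F hF using hr
  choose G hG using hl
  have hmul : ∀ {e e' f f'}, M e e' → M f f' → M (e * f) (e' * f') := fun h k =>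
    ⟨hP.mul h.1 k.1, hR.mul h.1 k.1 h.2.1 k.2.1,
      hC.mul (e := .op _) (e' := .op _) (f := .op _) (f' := .op _) k.1 h.1 k.2.2 h.2.2⟩
  exact ⟨
    { toFun := F
      invFun := G
      left_inv := fun e => hfun' (hG (F e)) (hF e)
      right_inv := fun e => hfun (hF (G e)) (hG e)
      map_mul' := fun e f => hfun (hF (e * f)) (hmul (hF e) (hF f)) },
    fun e => (hF e).1, fun e e' h k l => hfun (hF e) ⟨h, k, l⟩⟩

/-- A bijection along a difunctional relation `Q` can be corrected by finitely many transpositions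
so as to extend a given finite partial bijection along `Q`. -/
theorem exists_perm_extending {R ι : Type*} [Finite ι] (Q : R → R → Prop)
    (hQ : ∀ {r s a b}, Q r a → Q r b → Q s a → Q s b) (σ₀ : R ≃ R) (h₀ : ∀ r, Q r (σ₀ r))
    (f g : ι → R) (hfg : ∀ i, Q (f i) (g i)) (hinj : ∀ i j, f i = f j ↔ g i = g j) :
    ∃ σ : R ≃ R, (∀ r, Q r (σ r)) ∧ ∀ i, σ (f i) = g i := by
  classical
  have key : ∀ s : Set ι, s.Finite →
      ∃ σ : R ≃ R, (∀ r, Q r (σ r)) ∧ ∀ i ∈ s, σ (f i) = g i := by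
    intro s hs
    induction s, hs using Set.Finite.induction_on with
    | empty => exact ⟨σ₀, h₀, by simp⟩
    | @insert i s his _ ih =>
      obtain ⟨σ, hσ, hs⟩ := ih
      refine ⟨σ.trans (Equiv.swap (σ (f i)) (g i)), fun r => ?_, ?_⟩
      · rw [Equiv.trans_apply]
        rcases eq_or_ne (σ r) (σ (f i)) with h | h
        · rw [h, Equiv.swap_apply_left, σ.injective h]
          exact hfg i
        rcases eq_or_ne (σ r) (g i) with h' | h'
        · rw [h', Equiv.swap_apply_right]
          exact hQ (hfg i) (hσ _) (h' ▸ hσ r)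
        · rw [Equiv.swap_apply_of_ne_of_ne h h']
          exact hσ r
      · rintro j (rfl | hj)
        · simp
        · rw [Equiv.trans_apply, hs j hj]
          by_cases hij : g j = g i
          · rw [← hij, ← hs j hj, (hinj j i).2 hij, Equiv.swap_self]
            rfl
          · rw [Equiv.swap_apply_of_ne_of_ne _ hij]
            intro h
            rw [← hs j hj] at h
            exact hij ((hinj j i).1 (σ.injective h))
  obtain ⟨σ, h, k⟩ := key Set.univ Set.finite_univ
  exact ⟨σ, h, fun i => k i trivial⟩

end Assembly

/-! ### Row matchings for homogeneous linearly ordered bands -/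

section LinearRows

variable {B : Type u} [Band B]

/-- The relation of lying in one `ℛ`-class. -/
def rSetoid (B : Type u) [Band B] : Setoid B where
  r e f := e * f = f ∧ f * e = e
  iseqv :=
    { refl := fun e => ⟨mul_self e, mul_self e⟩
      symm := fun h => ⟨h.2, h.1⟩
      trans := fun {e f g} h k =>
        ⟨by rw [← k.1, ← mul_assoc, h.1], by rw [← h.2, ← mul_assoc, k.2]⟩ }

/-- Two elements, possibly from different `𝒟`-classes, lie in the same row: `ef` and `fe` lie in one
`ℛ`-class. -/
def SameRow (e f : B) : Prop := f * e * f = e * f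

theorem SameRow.refl (e : B) : SameRow e e := by simp [SameRow, mul_self]

theorem SameRow.symm {e f : B} (h : SameRow e f) : SameRow f e := by
  have h' : f * e * f = e * f := h
  have := mul_self (f * e)
  change e * f * e = f * e
  grind

theorem sameRow_mul (e f : B) : SameRow (e * f) e := by
  change e * (e * f) * e = e * f * e
  grind

theorem sameRow_of_below {e f : B} (h : Below e f) : SameRow e f ↔ f * e = e := by
  have h' : e * f * e = e := h
  constructor
  · intro k
    have k' : f * e * f = e * f := k
    have := mul_self (f * e)
    grind
  · intro k
    change f * e * f = e * f
    rw [k]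

theorem Realizes.sameRow_iff {ι : Type*} {m : ι → ι → ι} {f g : ι → B} (hf : Realizes m f)
    (hg : Realizes m g) (i j : ι) : SameRow (f i) (f j) ↔ SameRow (g i) (g j) := by
  unfold SameRow
  rw [hf.mul, hf.mul, hf.mul, hg.mul, hg.mul, hg.mul, hf.inj.eq_iff, hg.inj.eq_iff]

/-- If `e` and `g` are both left units of `f`, they lie in the same row. -/
theorem LeftConstant.mul_eq_self (hC : LeftConstant B) {e f g : B} (hge : Below e g)
    (hef : Below f e) (k₁ : e * f = f) (k₂ : g * f = f) : g * e = e := by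
  by_contra hne
  exact hC.inj (leftZero_mul hge hne) hef (by rw [mul_assoc, k₁, k₂])

/-- When elements act constantly on rows, rows are comparable across `𝒟`-classes. -/
theorem LeftConstant.sameRow_trans (hl : BelowTotal B) (hC : LeftConstant B) {e f g : B}
    (h : SameRow e f) (k : SameRow f g) : SameRow e g := by
  -- it suffices to treat the triples whose outer elements are ordered
  have key : ∀ {e f g : B}, Below e g → SameRow e f → SameRow f g → SameRow e g := by
    intro e f g heg h k
    rw [sameRow_of_below heg]
    rcases hl e f with hef | hfe
    · have h₁ := (sameRow_of_below hef).1 h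
      rcases hl f g with hfg | hgf
      · have h₂ := (sameRow_of_below hfg).1 k
        rw [← h₁, ← mul_assoc, h₂]
      · have h₂ := (sameRow_of_below hgf).1 k.symm
        by_contra hne
        have h₃ := hC.mul_eq hef (leftZero_mul heg hne)
        rw [h₁, ← mul_assoc, h₂] at h₃
        exact hne h₃.symm
    · have h₁ := (sameRow_of_below hfe).1 h.symm
      exact hC.mul_eq_self heg hfe h₁ ((sameRow_of_below (hfe.trans heg)).1 k)
  rcases hl e g with heg | hge
  · exact key heg h k
  · exact (key hge k.symm h.symm).symm

/-- The setoid of rows in the constant case. -/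
def LeftConstant.setoid (hl : BelowTotal B) (hC : LeftConstant B) : Setoid B where
  r := SameRow
  iseqv := ⟨SameRow.refl, SameRow.symm, hC.sameRow_trans hl⟩

/-- In the constant case rows are global and any permutation of them is compatible with any level
matching. -/
theorem LeftConstant.exists_rowMatching (hB : IsHomogeneous B) (hl : BelowTotal B)
    (hC : LeftConstant B) {P : B → B → Prop} (hP : LevelMatching P) {ι : Type*} [Finite ι]
    {m : ι → ι → ι} {f g : ι → B} (hf : Realizes m f) (hg : Realizes m g) :
    ∃ (R : Type u) (row : B → R) (σ : R ≃ R), RowMatching P row σ ∧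
      ∀ i, row (g i) = σ (row (f i)) := by
  let R := Quotient (hC.setoid hl)
  let row : B → R := Quotient.mk _
  have hrow : ∀ {e f}, row e = row f ↔ SameRow e f := Quotient.eq (r := hC.setoid hl)
  obtain ⟨σ, -, hσ⟩ := exists_perm_extending (fun _ _ : R => True) (fun _ _ _ => trivial)
    (Equiv.refl R) (fun _ => trivial) (fun i => row (f i)) (fun i => row (g i)) (fun _ => trivial)
    (fun i j => by rw [hrow, hrow]; exact hf.sameRow_iff hg i j)
  have hmul : ∀ e f, row (e * f) = row e := fun e f => hrow.2 (sameRow_mul e f)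
  -- every row meets every `𝒟`-class
  have hex : ∀ (r : R) (y : B), ∃ e, DRel e y ∧ row e = r := by
    intro r y
    obtain ⟨x, rfl⟩ := Quotient.exists_rep r
    rcases hl x y with h | h
    · obtain ⟨u, hu, hux, -⟩ := exists_dRel_above hB hl h
      exact ⟨u, hu, hrow.2 ((sameRow_of_below (h.trans hu.symm.below)).2 hux).symm⟩
    · exact ⟨x * y, dRel_mul_right h, hmul x y⟩
  refine ⟨R, row, σ, ⟨fun hd h => ?_, fun _ => hmul _ _, fun e => ?_, fun e' => ?_,
    fun _ _ h _ => by rw [hmul, hmul, h]⟩, fun i => (hσ i).symm⟩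
  · exact (sameRow_of_below hd.symm.below).1 (hrow.1 h).symm
  · obtain ⟨y, hy⟩ := hP.exists_right e
    obtain ⟨e', hd, hr⟩ := hex (σ (row e)) y
    exact ⟨e', hP.of_dRel hy hd.symm, hr⟩
  · obtain ⟨y, hy⟩ := hP.exists_left e'
    obtain ⟨e, hd, hr⟩ := hex (σ.symm (row e')) y
    exact ⟨e, hP.of_dRel_left hy hd.symm, by rw [hr, Equiv.apply_symm_apply]⟩

/-- In the trivial case the rows of different `𝒟`-classes are unrelated. The rows of matching
classes are equinumerous by homogeneity, and the bijections between them can be chosen class by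
class. -/
theorem LeftTrivial.exists_rowMatching (hB : IsHomogeneous B) (hl : BelowTotal B)
    (hT : LeftTrivial B) {P : B → B → Prop} (hP : LevelMatching P) {ι : Type*} [Finite ι]
    {m : ι → ι → ι} {f g : ι → B} (hf : Realizes m f) (hg : Realizes m g)
    (hfg : ∀ i, P (f i) (g i)) :
    ∃ (R : Type u) (row : B → R) (σ : R ≃ R), RowMatching P row σ ∧
      ∀ i, row (g i) = σ (row (f i)) := by
  classical
  let R := Quotient (rSetoid B)
  let row : B → R := Quotient.mk _
  have hrow : ∀ {e f}, row e = row f ↔ e * f = f ∧ f * e = e := Quotient.eq (r := rSetoid B)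
  have hD : ∀ {e f}, row e = row f → DRel e f := fun h => by
    obtain ⟨h₁, h₂⟩ := hrow.1 h
    exact ⟨by rw [h₁, h₂], by rw [h₂, h₁]⟩
  have hmul : ∀ {e f}, Below e f → row (e * f) = row e := fun {e f} h => by
    have h' : e * f * e = e := h
    exact hrow.2 ⟨h', by grind⟩
  have hmul' : ∀ {e f}, Below f e → ¬ Below e f → row (e * f) = row f := fun {e f} h h' => by
    rw [hT e f h h']
  -- automorphisms realizing `P`, one for each `𝒟`-class
  have hΦ : ∀ y : StructureSemilattice B, ∃ Φ : B ≃* B, ∀ e, cls e = y → P e (Φ e) := by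
    rintro ⟨b⟩
    obtain ⟨b', hb⟩ := hP.exists_right b
    obtain ⟨Φ, rfl⟩ := hB.exists_map_eq b b'
    refine ⟨Φ, fun e he => ?_⟩
    have hd : DRel e b := (cls_eq_iff e b).1 he
    exact hP.of_dRel (hP.of_dRel_left hb hd.symm) (hd.map Φ).symm
  choose Φ hΦ using hΦ
  have hmap : ∀ (Φ : B ≃* B) {e f}, row (Φ e) = row (Φ f) ↔ row e = row f := by
    intro Φ e f
    rw [hrow, hrow, ← map_mul, ← map_mul, Φ.injective.eq_iff, Φ.injective.eq_iff]
  let s : R → R := Quotient.lift (fun e => row (Φ (cls e) e)) fun e f h => by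
    have h' : row e = row f := hrow.2 h
    rw [(cls_eq_iff e f).2 (hD h'), hmap, h']
  have hs : ∀ e, s (row e) = row (Φ (cls e) e) := fun _ => rfl
  have hbij : Function.Bijective s := by
    constructor
    · intro r₁ r₂ h
      obtain ⟨e, rfl⟩ := Quotient.exists_rep r₁
      obtain ⟨f, rfl⟩ := Quotient.exists_rep r₂
      have h : row (Φ (cls e) e) = row (Φ (cls f) f) := h
      have hef : cls e = cls f :=
        (cls_eq_iff e f).2 ((hP.dRel_iff (hΦ _ e rfl) (hΦ _ f rfl)).2 (hD h))
      rw [hef] at h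
      exact (hmap _).1 h
    · intro r
      obtain ⟨e', rfl⟩ := Quotient.exists_rep r
      obtain ⟨b, hb⟩ := hP.exists_left e'
      refine ⟨row ((Φ (cls b)).symm e'), ?_⟩
      have hd := ((hP.dRel_iff hb (hΦ _ b rfl)).1 (DRel.refl b)).map (Φ (cls b)).symm
      rw [MulEquiv.symm_apply_apply, ← cls_eq_iff] at hd
      rw [hs, hd, MulEquiv.apply_symm_apply]
  let Q : R → R → Prop := fun r r' => ∃ e e', row e = r ∧ row e' = r' ∧ P e e'
  have hQ : ∀ {e e'}, Q (row e) (row e') ↔ P e e' := by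
    intro e e'
    constructor
    · rintro ⟨f, f', hf, hf', h⟩
      exact hP.of_dRel (hP.of_dRel_left h (hD hf)) (hD hf')
    · exact fun h => ⟨e, e', rfl, rfl, h⟩
  obtain ⟨σ, hσQ, hσ⟩ := exists_perm_extending Q (by
      intro r₁ r₂ r₃ r₄
      obtain ⟨a, rfl⟩ := Quotient.exists_rep r₁
      obtain ⟨b, rfl⟩ := Quotient.exists_rep r₂
      obtain ⟨c, rfl⟩ := Quotient.exists_rep r₃
      obtain ⟨d, rfl⟩ := Quotient.exists_rep r₄
      intro h₁ h₂ h₃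
      have h₁ := hQ.1 h₁
      have h₂ := hQ.1 h₂
      have h₃ := hQ.1 h₃
      exact hQ.2 (hP.of_dRel_left h₂ ((hP.dRel_iff h₁ h₃).2 (DRel.refl c))))
    (Equiv.ofBijective s hbij) (by
      intro r
      obtain ⟨e, rfl⟩ := Quotient.exists_rep r
      exact hQ.2 (hΦ _ e rfl))
    (fun i => row (f i)) (fun i => row (g i)) (fun i => hQ.2 (hfg i))
    (fun i j => by
      rw [hrow, hrow, hf.mul, hf.mul, hg.mul, hg.mul, hf.inj.eq_iff, hf.inj.eq_iff,
        hg.inj.eq_iff, hg.inj.eq_iff])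
  refine ⟨R, row, σ, ⟨fun hd h => (hrow.1 h).1, fun hd => hmul hd.below, fun e => ?_,
    fun e' => ?_, fun {e e' f f'} he hf he' hf' => ?_⟩, fun i => (hσ i).symm⟩
  · obtain ⟨e', he'⟩ := Quotient.exists_rep (σ (row e))
    have he' : row e' = σ (row e) := he'
    exact ⟨e', hQ.1 (he' ▸ hσQ (row e)), he'⟩
  · obtain ⟨e, he⟩ := Quotient.exists_rep (σ.symm (row e'))
    have he : row e' = σ (row e) := by
      rw [show row e = _ from he, Equiv.apply_symm_apply]
    exact ⟨e, hQ.1 (he ▸ hσQ (row e)), he⟩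
  · by_cases hef : Below e f
    · rw [hmul hef, hmul ((hP.below_iff he hf).1 hef), he']
    · have hfe := (hl e f).resolve_left hef
      rw [hmul' hfe hef, hmul' ((hP.below_iff hf he).1 hfe) (mt (hP.below_iff he hf).2 hef), hf']

theorem exists_rowMatching (hB : IsHomogeneous B) (hl : BelowTotal B) {P : B → B → Prop}
    (hP : LevelMatching P) {ι : Type*} [Finite ι] {m : ι → ι → ι} {f g : ι → B}
    (hf : Realizes m f) (hg : Realizes m g) (hfg : ∀ i, P (f i) (g i)) :
    ∃ (R : Type u) (row : B → R) (σ : R ≃ R), RowMatching P row σ ∧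
      ∀ i, row (g i) = σ (row (f i)) := by
  rcases leftTrivial_or_leftConstant hB hl with h | h
  · exact h.exists_rowMatching hB hl hP hf hg hfg
  · exact h.exists_rowMatching hB hl hP hf hg

/-- For a homogeneous linearly ordered band the rows and the columns can be matched independently
of each other and over any automorphism of the chain of `𝒟`-classes. -/
theorem IsHomogeneous.isStructureHomogeneous (hB : IsHomogeneous B) (hl : BelowTotal B) :
    IsStructureHomogeneous B := by
  refine ⟨hB, fun A₁ A₂ _ _ θ ρ hρ => ?_⟩
  have hP : LevelMatching (fun e e' : B => ρ (cls e) = cls e') :=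
    LevelMatching.of_mulEquiv cls_mul (by rintro ⟨e⟩; exact ⟨e, rfl⟩) (fun _ _ => below_iff)
      (structureSemilattice_isSemilattice B) ρ
  have hf := Realizes.of_subsemigroup A₁
  have hg := Realizes.of_mulEquiv θ
  obtain ⟨R, row, σ, hR, hσ⟩ := exists_rowMatching hB hl hP hf hg hρ
  obtain ⟨C, col, τ, hC, hτ⟩ := exists_rowMatching hB.op hl.op hP.op
    (m := fun i j => j * i) (f := fun i : A₁ => .op (i : B)) (g := fun i => .op (θ i : B))
    ⟨MulOpposite.op_injective.comp hf.inj, fun i j => congrArg MulOpposite.op (hf.mul j i)⟩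
    ⟨MulOpposite.op_injective.comp hg.inj, fun i j => congrArg MulOpposite.op (hg.mul j i)⟩ hρ
  obtain ⟨Θ, h₁, h₂⟩ := exists_mulEquiv_of_matchings hP hR hC
  exact ⟨Θ, fun a => h₂ _ _ (hρ a) (hσ a) (hτ a), h₁⟩

end LinearRows

/-! ### Products of a homogeneous semilattice and a rectangular band -/

section Product

variable {B Y : Type u} [Band B] [Band Y] {I J : Type}

theorem below_iff_of_product (φ : B ≃* Y × Rect I J) (hY : IsSemilattice Y) (e f : B) :
    Below e f ↔ (φ e).1 * (φ f).1 = (φ e).1 := by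
  have hmul : ∀ a b : Rect I J, a * b = ⟨a.row, b.col⟩ := fun _ _ => rfl
  unfold Below
  rw [← φ.injective.eq_iff, map_mul, map_mul, Prod.ext_iff]
  simp only [Prod.fst_mul, Prod.snd_mul, hmul, and_true]
  rw [hY, ← mul_assoc, mul_self]

theorem dRel_iff_of_product (φ : B ≃* Y × Rect I J) (hY : IsSemilattice Y) (e f : B) :
    DRel e f ↔ (φ e).1 = (φ f).1 := by
  rw [dRel_iff, below_iff_of_product φ hY, below_iff_of_product φ hY]
  constructor
  · rintro ⟨h, k⟩
    rw [← h, hY, k]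
  · intro h
    rw [h, mul_self]
    exact ⟨rfl, rfl⟩

theorem sameRow_iff_of_product (φ : B ≃* Y × Rect I J) (hY : IsSemilattice Y) (e f : B) :
    SameRow e f ↔ (φ e).2.row = (φ f).2.row := by
  have hmul : ∀ a b : Rect I J, a * b = ⟨a.row, b.col⟩ := fun _ _ => rfl
  unfold SameRow
  rw [← φ.injective.eq_iff, map_mul, map_mul, map_mul, Prod.ext_iff]
  simp only [Prod.fst_mul, Prod.snd_mul, hmul, Rect.mk.injEq, and_true]
  constructor
  · exact fun h => h.2.symm
  · intro h
    refine ⟨?_, h.symm⟩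
    rw [hY (φ f).1, mul_assoc, mul_self]

theorem exists_rowMatching_of_product (φ : B ≃* Y × Rect I J) (hY : IsSemilattice Y)
    {P : B → B → Prop} (hP : LevelMatching P) {ι : Type*} [Finite ι] {m : ι → ι → ι}
    {f g : ι → B} (hf : Realizes m f) (hg : Realizes m g) :
    ∃ σ : I ≃ I, RowMatching P (fun e => (φ e).2.row) σ ∧
      ∀ i, (φ (g i)).2.row = σ (φ (f i)).2.row := by
  obtain ⟨σ, -, hσ⟩ := exists_perm_extending (fun _ _ : I => True) (fun _ _ _ => trivial)
    (Equiv.refl I) (fun _ => trivial) (fun i => (φ (f i)).2.row) (fun i => (φ (g i)).2.row)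
    (fun _ => trivial) (fun i j => by
      rw [← sameRow_iff_of_product φ hY, ← sameRow_iff_of_product φ hY]
      exact hf.sameRow_iff hg i j)
  have hmul : ∀ e f : B, (φ (e * f)).2.row = (φ e).2.row := fun e f => by
    rw [map_mul]; rfl
  have hex : ∀ (r : I) (y : B), ∃ e, DRel e y ∧ (φ e).2.row = r := fun r y =>
    ⟨φ.symm ((φ y).1, ⟨r, (φ y).2.col⟩), by rw [dRel_iff_of_product φ hY]; simp, by simp⟩
  refine ⟨σ, ⟨fun {e f} hd h => ?_, fun _ => hmul _ _, fun e => ?_, fun e' => ?_,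
    fun _ _ h _ => by rw [hmul, hmul, h]⟩, fun i => (hσ i).symm⟩
  · exact (sameRow_of_below hd.symm.below).1 ((sameRow_iff_of_product φ hY f e).2 h.symm)
  · obtain ⟨y, hy⟩ := hP.exists_right e
    obtain ⟨e', hd, hr⟩ := hex (σ (φ e).2.row) y
    exact ⟨e', hP.of_dRel hy hd.symm, hr⟩
  · obtain ⟨y, hy⟩ := hP.exists_left e'
    obtain ⟨e, hd, hr⟩ := hex (σ.symm (φ e').2.row) y
    exact ⟨e, hP.of_dRel_left hy hd.symm, by rw [hr, Equiv.apply_symm_apply]⟩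

/-- The opposite of `Y × (I × J)` is `Y × (J × I)`. -/
def productOp (φ : B ≃* Y × Rect I J) (hY : IsSemilattice Y) : Bᵐᵒᵖ ≃* Y × Rect J I where
  toFun b := ((φ b.unop).1, ⟨(φ b.unop).2.col, (φ b.unop).2.row⟩)
  invFun p := .op (φ.symm (p.1, ⟨p.2.col, p.2.row⟩))
  left_inv b := MulOpposite.unop_injective (φ.symm_apply_apply b.unop)
  right_inv p := by simp
  map_mul' a b := by
    rw [MulOpposite.unop_mul, map_mul]
    exact Prod.ext (hY _ _) rfl

theorem exists_extension_of_product (φ : B ≃* Y × Rect I J) (hY : IsSemilattice Y)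
    {P : B → B → Prop} (hP : LevelMatching P) {A₁ A₂ : Subsemigroup B} [Finite A₁]
    (θ : A₁ ≃* A₂) (hθ : ∀ a : A₁, P a (θ a)) :
    ∃ Θ : B ≃* B, (∀ a : A₁, Θ a = θ a) ∧ ∀ e, P e (Θ e) := by
  have hf := Realizes.of_subsemigroup A₁
  have hg := Realizes.of_mulEquiv θ
  obtain ⟨σ, hR, hσ⟩ := exists_rowMatching_of_product φ hY hP hf hg
  obtain ⟨τ, hC, hτ⟩ := exists_rowMatching_of_product (productOp φ hY) hY hP.op
    (m := fun i j => j * i) (f := fun i : A₁ => .op (i : B)) (g := fun i => .op (θ i : B))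
    ⟨MulOpposite.op_injective.comp hf.inj, fun i j => congrArg MulOpposite.op (hf.mul j i)⟩
    ⟨MulOpposite.op_injective.comp hg.inj, fun i j => congrArg MulOpposite.op (hg.mul j i)⟩
  obtain ⟨Θ, h₁, h₂⟩ := exists_mulEquiv_of_matchings hP hR hC
  exact ⟨Θ, fun a => h₂ _ _ (hθ a) (hσ a) (hτ a), h₁⟩

theorem isStructureHomogeneous_of_product [Nonempty I] [Nonempty J] (φ : B ≃* Y × Rect I J)
    (hY : IsSemilattice Y) (hYh : IsHomogeneous Y) : IsStructureHomogeneous B := by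
  constructor
  · intro A₁ A₂ _ _ θ
    let c : B → Y := fun b => (φ b).1
    have hc : ∀ e f, c (e * f) = c e * c f := fun e f => by simp [c]
    have hs : Function.Surjective c := fun y =>
      ⟨φ.symm (y, ⟨Classical.arbitrary I, Classical.arbitrary J⟩), by simp [c]⟩
    -- the isomorphism between the supports in `Y`
    have hθ : ∀ a b : A₁, c a = c b ↔ c (θ a) = c (θ b) := by
      intro a b
      rw [← dRel_iff_of_product φ hY, ← dRel_iff_of_product φ hY]
      unfold DRel
      norm_cast
      rw [← map_mul, ← map_mul, ← map_mul, ← map_mul, θ.injective.eq_iff, θ.injective.eq_iff]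
    let S : Set Y := Set.range fun a : A₁ => c a
    choose r hr using fun s : S => s.2
    have hrr : ∀ s t : S, c ((r s : B) * r t) = s * t := fun s t =>
      (hc _ _).trans (congrArg₂ _ (hr s) (hr t))
    obtain ⟨ψ, hψ⟩ := hYh.exists_mulEquiv (ι := S)
      (m := fun s t => ⟨s * t, r s * r t, hrr s t⟩)
      (f := fun s => s) (g := fun s => c (θ (r s)))
      ⟨Subtype.val_injective, fun _ _ => rfl⟩
      ⟨fun s t h => Subtype.ext (by
          have := (hθ (r s) (r t)).2 h
          rwa [show c (r s) = s from hr s, show c (r t) = t from hr t] at this),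
        fun s t => by
          rw [← hc, ← MulMemClass.coe_mul, ← map_mul, ← hθ]
          exact (hrr s t).trans (hr ⟨s * t, r s * r t, hrr s t⟩).symm⟩
    have hP : LevelMatching (fun e e' => ψ (c e) = c e') :=
      LevelMatching.of_mulEquiv hc hs (below_iff_of_product φ hY) hY ψ
    obtain ⟨Θ, hΘ, -⟩ := exists_extension_of_product φ hY hP θ (fun a => by
      have h := hψ ⟨c a, a, rfl⟩
      exact h.trans ((hθ _ _).1 (hr ⟨c a, a, rfl⟩)))
    exact ⟨Θ, hΘ⟩
  · intro A₁ A₂ _ _ θ ρ hρ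
    have hP : LevelMatching (fun e e' : B => ρ (cls e) = cls e') :=
      LevelMatching.of_mulEquiv cls_mul (by rintro ⟨e⟩; exact ⟨e, rfl⟩) (fun _ _ => below_iff)
        (structureSemilattice_isSemilattice B) ρ
    exact exists_extension_of_product φ hY hP θ hρ

theorem nonempty_index {n : ℕ∞} (h : 1 ≤ n) : Nonempty (Index n) := by
  cases n with
  | top => exact ⟨(0 : ℕ)⟩
  | coe k => exact ⟨(⟨0, by exact_mod_cast h⟩ : Fin k)⟩

end Product

/-! ### Structure-homogeneous bands that are not linearly ordered -/

section NonLinear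

variable {B : Type u} [Band B]

/-- Isomorphisms between finite subbands that preserve each `𝒟`-class extend to automorphisms that
preserve each `𝒟`-class. -/
def IsClassHomogeneous (B : Type u) [Band B] : Prop :=
  ∀ (n : ℕ) (m : Fin n → Fin n → Fin n) (f g : Fin n → B), Realizes m f → Realizes m g →
    (∀ i, DRel (f i) (g i)) → ∃ Φ : B ≃* B, (∀ i, Φ (f i) = g i) ∧ ∀ b, DRel (Φ b) b

theorem IsStructureHomogeneous.isClassHomogeneous (hB : IsStructureHomogeneous B) :
    IsClassHomogeneous B := by
  intro n m f g hf hg hd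
  obtain ⟨Φ, h, k⟩ := hB.2 hf.range hg.range (Set.finite_range f) (Set.finite_range g)
    (hf.iso hg) (MulEquiv.refl _) (by
      intro a
      obtain ⟨i, rfl⟩ := hf.equivRange.surjective a
      rw [hf.iso_apply hg, hf.coe_equivRange, hg.coe_equivRange]
      exact (cls_eq_iff _ _).2 (hd i))
  refine ⟨Φ, fun i => ?_, fun b => ((cls_eq_iff _ _).1 (k b)).symm⟩
  have h := h (hf.equivRange i)
  rwa [hf.iso_apply hg, hf.coe_equivRange, hg.coe_equivRange] at h

theorem IsClassHomogeneous.op (hK : IsClassHomogeneous B) : IsClassHomogeneous Bᵐᵒᵖ := by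
  intro n m f g hf hg hd
  obtain ⟨Φ, h, k⟩ := hK n _ _ _ hf.unop hg.unop fun i => dRel_op.1 (hd i)
  exact ⟨MulEquiv.op Φ, fun i => MulOpposite.unop_injective (h i), fun b => dRel_op.2 (k b.unop)⟩

/-- `x ≤ u` in the natural order. -/
def Under (x u : B) : Prop := u * x = x ∧ x * u = x

theorem Under.below {x u : B} (h : Under x u) : Below x u := by
  rw [Below, h.2, mul_self]

theorem Under.map {x u : B} (h : Under x u) (Φ : B ≃* B) : Under (Φ x) (Φ u) :=
  ⟨by rw [← map_mul, h.1], by rw [← map_mul, h.2]⟩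

theorem Under.eq_of_dRel {x u : B} (h : Under x u) (hd : DRel u x) : u = x := by
  have h' : u * x * u = u := hd.1
  rw [← h', h.1, h.2]

theorem Under.chain {x u : B} (h : Under x u) (h' : ¬ Below u x) : Chain x u :=
  ⟨fun hh => h' (hh ▸ Below.refl _), h.1, h.2⟩

theorem sandwich_under (u x : B) : Under (u * x * u) u := ⟨by grind, by grind⟩

theorem IsClassHomogeneous.exists_map_eq (hK : IsClassHomogeneous B) {x y : B} (h : DRel x y) :
    ∃ Φ : B ≃* B, Φ x = y ∧ ∀ b, DRel (Φ b) b := by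
  obtain ⟨Φ, h₁, h₂⟩ := hK 1 (fun i _ => i) (fun _ => x) (fun _ => y)
    ⟨fun _ _ _ => Subsingleton.elim _ _, fun _ _ => mul_self _⟩
    ⟨fun _ _ _ => Subsingleton.elim _ _, fun _ _ => mul_self _⟩ fun _ => h
  exact ⟨Φ, h₁ 0, h₂⟩

/-- The element `vxv` lies below `v` and in the class of `x`; move it to `x`. -/
theorem IsClassHomogeneous.exists_above (hK : IsClassHomogeneous B) {x v : B} (h : Below x v) :
    ∃ u, DRel u v ∧ Under x u := by
  have hd : DRel (v * x * v) x := by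
    rw [below_iff] at h
    rw [← cls_eq_iff, cls_mul, cls_mul]
    grind
  obtain ⟨Φ, h₁, h₂⟩ := hK.exists_map_eq hd
  exact ⟨Φ v, h₂ v, by simpa [h₁] using (sandwich_under v x).map Φ⟩

/-- Let `a` and `b` be incomparable. Two different elements of one `𝒟`-class below a common `u`
could be moved both below `a` and below some `v` in the class of `b`, and would then both be equal
to `ava`. -/
theorem under_unique (hB : IsHomogeneous B) (hK : IsClassHomogeneous B) (hl : ¬ BelowTotal B)
    {u x y : B} (hx : Under x u) (hy : Under y u) (hd : DRel x y) : x = y := by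
  -- it suffices to treat two-element subbands
  have key : ∀ (m : Fin 2 → Fin 2 → Fin 2) (f : Fin 2 → B), Realizes m f →
      (∀ i, Under (f i) u) → DRel (f 0) (f 1) → False := by
    intro m f hf hu hd
    have hne : f 0 ≠ f 1 := fun h => by simpa using hf.inj h
    have h0 : ¬ Below u (f 0) := by
      intro h
      have h0 : DRel u (f 0) := ⟨h, (hu 0).below⟩
      exact hne (((hu 0).eq_of_dRel h0).symm.trans ((hu 1).eq_of_dRel (h0.trans hd)))
    have hch := (hu 0).chain h0
    unfold BelowTotal at hl
    push Not at hl
    obtain ⟨a, b, hab, hba⟩ := hl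
    have hac : cls (a * b * a) = cls a * cls b := by
      rw [cls_mul, cls_mul]; grind
    have hbc : cls (b * a * b) = cls a * cls b := by
      rw [cls_mul, cls_mul]; grind
    have hsw : ∀ p q : B, Below (p * q * p) q := fun p q => by
      rw [below_iff, cls_mul, cls_mul]; grind
    have hca : Chain (a * b * a) a := (sandwich_under a b).chain (mt (·.trans (hsw a b)) hab)
    have hcb : Chain (b * a * b) b := (sandwich_under b a).chain (mt (·.trans (hsw b a)) hba)
    obtain ⟨Φ, hΦx, hΦu⟩ := hB.exists_map_chain hch hca
    obtain ⟨Ψ, hΨx, hΨu⟩ := hB.exists_map_chain hch hcb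
    have hΦc : ∀ i, cls (Φ (f i)) = cls a * cls b := by
      have h1 := (cls_eq_iff _ _).2 (hd.map Φ)
      intro i
      fin_cases i
      · simpa [hΦx] using hac
      · simpa [hΦx, ← h1] using hac
    have hΨc : ∀ i, cls (Ψ (f i)) = cls a * cls b := by
      have h1 := (cls_eq_iff _ _).2 (hd.map Ψ)
      intro i
      fin_cases i
      · simpa [hΨx] using hbc
      · simpa [hΨx, ← h1] using hbc
    obtain ⟨Θ, hΘ, hΘd⟩ := hK 2 m _ _ (hf.map Ψ) (hf.map Φ) fun i => by
      rw [← cls_eq_iff, hΦc, hΨc]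
    have hcv : cls (Θ b) = cls b := (cls_eq_iff _ _).2 (hΘd b)
    have hall : ∀ i, a * Θ b * a = Φ (f i) := by
      intro i
      have h1 : Under (Φ (f i)) a := hΦu ▸ (hu i).map Φ
      have h2 : Under (Φ (f i)) (Θ b) := by
        have := ((hu i).map Ψ).map Θ
        rwa [hΘ, hΨu] at this
      obtain ⟨p₁, p₂⟩ := h1
      obtain ⟨q₁, q₂⟩ := h2
      refine Under.eq_of_dRel ⟨by grind, by grind⟩ ?_
      rw [← cls_eq_iff, hΦc, cls_mul, cls_mul, hcv]
      grind
    exact hne (Φ.injective ((hall 0).symm.trans (hall 1)))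
  by_contra hne
  have k₁ : x * y * x = x := hd.1
  have k₂ : y * x * y = y := hd.2
  obtain ⟨x₁, x₂⟩ := hx
  obtain ⟨y₁, y₂⟩ := hy
  by_cases h : x = y * x
  · have h' : x * y = y := by grind
    refine key _ _ (realizes_of_rightZero hne h' h.symm) ?_ hd
    intro i
    fin_cases i
    · exact ⟨x₁, x₂⟩
    · exact ⟨y₁, y₂⟩
  · have hz : LeftZero x (y * x) := leftZero_mul hd.below (Ne.symm h)
    refine key _ _ hz.realizes ?_ hz.dRel
    intro i
    fin_cases i
    · exact ⟨x₁, x₂⟩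
    · exact ⟨by simp [← mul_assoc, y₁], by simp [mul_assoc, x₂]⟩

/-- No two elements of an `ℒ`-class lie above a common element of a lower class. Otherwise every
such pair has a common lower bound in every lower class. Given a left-zero pair `x, h` in the lower
class, an element `k` above `h` in the class of `u` then fixes `x` on the left, whence `xk` lies
below `k` and equals `h`, and so `x = h`. -/
theorem not_leftZero_of_under (hB : IsHomogeneous B) (hK : IsClassHomogeneous B)
    (hU : ∀ u x y : B, Under x u → Under y u → DRel x y → x = y)
    {u v x : B} (hu : Under x u) (hv : Under x v) (huv : LeftZero u v) : False := by
  have hux : ¬ Below u x := by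
    intro h
    have h0 : DRel u x := ⟨h, hu.below⟩
    exact huv.ne ((hu.eq_of_dRel h0).trans (hv.eq_of_dRel (huv.dRel.symm.trans h0)).symm)
  have key : ∀ {p q z : B}, LeftZero p q → Below z p → ¬ Below p z →
      ∃ t, Under t p ∧ Under t q ∧ DRel t z := by
    intro p q z hpq hz hz'
    obtain ⟨hc, hd⟩ := chain_of_below hz hz'
    obtain ⟨Φ, hΦx, hΦu⟩ := hB.exists_map_chain (hu.chain hux) hc
    have hm := huv.map Φ
    rw [hΦu] at hm
    obtain ⟨Θ, hΘ, hΘd⟩ := hK 2 _ _ _ hm.realizes hpq.realizes (by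
      have := hm.dRel.symm.trans hpq.dRel
      intro i
      fin_cases i
      · exact DRel.refl _
      · exact this)
    have h0 : Θ p = p := by simpa using hΘ 0
    have h1 : Θ (Φ v) = q := by simpa using hΘ 1
    refine ⟨Θ (Φ x), ?_, ?_, ?_⟩
    · simpa [hΦu, h0] using (hu.map Φ).map Θ
    · simpa [h1] using (hv.map Φ).map Θ
    · exact (hΘd _).trans (hΦx ▸ hd)
  obtain ⟨h, hxh⟩ : ∃ h, LeftZero x h := by
    obtain ⟨Φ, hΦ⟩ := hB.exists_map_eq u x
    exact ⟨Φ v, hΦ ▸ huv.map Φ⟩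
  obtain ⟨k, hku, hk⟩ := hK.exists_above (hxh.dRel.symm.below.trans hu.below)
  have h₁ : k * x = x := by
    have e : k * u * x = x := by
      by_cases hne : k * u = u
      · rw [hne, hu.1]
      · obtain ⟨t, ht, ht', htd⟩ := key (leftZero_mul hku.symm.below hne) hu.below hux
        have : t = x := hU u t x ht hu htd
        rw [this] at ht'
        exact ht'.1
    rwa [mul_assoc, hu.1] at e
  have hkx : DRel (x * k) h := by
    refine (dRel_mul_left ?_).trans hxh.dRel
    exact hu.below.trans hku.symm.below
  have h₂ : x * k = h :=
    hU k _ _ ⟨by rw [← mul_assoc, h₁], by rw [mul_assoc, mul_self]⟩ hk hkx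
  apply hxh.ne
  rw [← hxh.left, ← h₂, ← mul_assoc, mul_self]

/-- Two-sided form of `not_leftZero_of_under`. -/
theorem eq_of_under (hB : IsHomogeneous B) (hK : IsClassHomogeneous B)
    (hU : ∀ u x y : B, Under x u → Under y u → DRel x y → x = y)
    {u v x : B} (hu : Under x u) (hv : Under x v) (huv : DRel u v) : u = v := by
  have hop : ∀ {a b : Bᵐᵒᵖ}, Under a b → Under a.unop b.unop := fun h =>
    ⟨congrArg MulOpposite.unop h.2, congrArg MulOpposite.unop h.1⟩
  have h₁ : v * u = u := by
    by_contra hne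
    refine not_leftZero_of_under hB hK hU hu ?_ (leftZero_mul huv.below hne)
    exact ⟨by rw [mul_assoc, hu.1, hv.1], by rw [← mul_assoc, hv.2, hu.2]⟩
  have h₂ : u * v = u := by
    by_contra hne
    have hb : Below (MulOpposite.op u) (.op v) := below_op.2 huv.below
    refine not_leftZero_of_under hB.op hK.op
      (fun a b c h k hd => MulOpposite.unop_injective (hU _ _ _ (hop h) (hop k) (dRel_op.1 hd)))
      (u := .op u) (v := .op v * .op u) (x := .op x) ?_ ?_ (leftZero_mul hb ?_)
    · exact ⟨congrArg MulOpposite.op hu.2, congrArg MulOpposite.op hu.1⟩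
    · exact ⟨congrArg MulOpposite.op (show x * (u * v) = x by rw [← mul_assoc, hu.2, hv.2]),
        congrArg MulOpposite.op (show u * v * x = x by rw [mul_assoc, hv.1, hu.1])⟩
    · exact fun h => hne (MulOpposite.op_injective h)
  have h₃ : v * u * v = v := huv.2
  rw [← h₃, h₁, h₂]

/-- A band in which each element has exactly one element below it in each lower `𝒟`-class, and
exactly one element above it in each higher one. -/
structure IsUniform (B : Type u) [Band B] : Prop where
  below_unique : ∀ {u x y : B}, Under x u → Under y u → DRel x y → x = y
  above_unique : ∀ {u v x : B}, Under x u → Under x v → DRel u v → u = v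
  exists_above : ∀ {x v : B}, Below x v → ∃ u, DRel u v ∧ Under x u

namespace IsUniform

theorem op (h : IsUniform B) : IsUniform Bᵐᵒᵖ := by
  have hop : ∀ {a b : Bᵐᵒᵖ}, Under a b → Under a.unop b.unop := fun h =>
    ⟨congrArg MulOpposite.unop h.2, congrArg MulOpposite.unop h.1⟩
  refine ⟨fun a b hd => MulOpposite.unop_injective (h.below_unique (hop a) (hop b) (dRel_op.1 hd)),
    fun a b hd => MulOpposite.unop_injective (h.above_unique (hop a) (hop b) (dRel_op.1 hd)),
    fun {x v} hb => ?_⟩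
  obtain ⟨u, hu, hxu⟩ := h.exists_above (below_op.1 hb)
  exact ⟨.op u, dRel_op.2 hu, congrArg MulOpposite.op hxu.2, congrArg MulOpposite.op hxu.1⟩

/-- Uniform bands are normal: the value of a product `ewf` depends on `w` only through its class. -/
theorem mul_mul_eq (h : IsUniform B) {w w' : B} (hw : DRel w w') (e f : B) :
    e * w * f = e * w' * f := by
  have key : ∀ e {w w' : B}, DRel w w' → e * w * e = e * w' * e := by
    intro e w w' hw
    refine h.below_unique (sandwich_under e w) (sandwich_under e w') ?_
    rw [← cls_eq_iff] at *
    simp only [cls_mul, hw]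
  have hd : ∀ g : B, DRel (w * g) (w' * g) ∧ DRel (g * w) (g * w') := by
    intro g
    rw [← cls_eq_iff] at *
    rw [← cls_eq_iff]
    simp only [cls_mul, hw, and_self]
  have h₁ := key e (hd f).1
  have h₂ := key f (hd e).2
  have h₃ := mul_self (e * w * f)
  have h₄ := mul_self (e * w' * f)
  grind

/-- The words `eg` and `geg` have a common lower bound, so they are equal by uniqueness of upper
elements. -/
theorem sameRow_trans (h : IsUniform B) {e f g : B} (hef : SameRow e f) (hfg : SameRow f g) :
    SameRow e g := by
  have k₁ : f * e * f = e * f := hef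
  have k₂ : g * f * g = f * g := hfg
  have hcomm : DRel (g * f) (f * g) := by
    rw [← cls_eq_iff, cls_mul, cls_mul]; grind
  have hd : DRel (e * f * g * e) (g * (e * f * e)) := by
    rw [← cls_eq_iff]; simp only [cls_mul]; grind
  -- a common lower bound of `eg` and `geg`
  obtain ⟨x, hx⟩ : ∃ x, x = e * g * f * (e * g) := ⟨_, rfl⟩
  have hx₁ : Under x (e * g) := by
    have := mul_self (e * g)
    exact ⟨by rw [hx]; grind, by rw [hx]; grind⟩
  have hgx : g * x = x := by
    have b : x = f * g * (e * f * e) * g := calc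
      x = e * (g * f) * (e * g) := by rw [hx]; simp only [mul_assoc]
      _ = e * f * (g * e * g) := by rw [h.mul_mul_eq hcomm]; simp only [mul_assoc]
      _ = f * e * f * (g * e * g) := by rw [k₁]
      _ = f * (e * f * g * e) * g := by simp only [mul_assoc]
      _ = f * g * (e * f * e) * g := by rw [h.mul_mul_eq hd]; simp only [mul_assoc]
    rw [b, ← k₂]
    simp only [← mul_assoc, mul_self]
  have hx₂ : Under x (g * e * g) := by
    obtain ⟨c₁, c₂⟩ := hx₁
    exact ⟨by grind, by grind⟩
  refine h.above_unique hx₂ hx₁ ?_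
  rw [← cls_eq_iff]; simp only [cls_mul]; grind

/-- The setoid of rows of a uniform band. -/
def setoid (h : IsUniform B) : Setoid B where
  r := SameRow
  iseqv := ⟨SameRow.refl, SameRow.symm, h.sameRow_trans⟩

/-- The rows of a uniform band. -/
abbrev Row (h : IsUniform B) : Type u := Quotient h.setoid

/-- The row of an element. -/
def row (h : IsUniform B) (e : B) : h.Row := Quotient.mk _ e

theorem row_eq_iff (h : IsUniform B) {e f : B} : h.row e = h.row f ↔ SameRow e f :=
  Quotient.eq (r := h.setoid)

theorem row_mul (h : IsUniform B) (e f : B) : h.row (e * f) = h.row e :=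
  h.row_eq_iff.2 (sameRow_mul e f)

theorem exists_row_eq (h : IsUniform B) (e y : B) : ∃ u, DRel u y ∧ h.row u = h.row e := by
  have hb : Below (e * y) y := by
    rw [below_iff, cls_mul]; grind
  obtain ⟨u, hu, hx⟩ := h.exists_above hb
  refine ⟨u, hu, ?_⟩
  rw [← h.row_mul e y, eq_comm, h.row_eq_iff, sameRow_of_below hx.below]
  exact hx.1

/-- A uniform band is the direct product of its structure semilattice and a rectangular band. -/
theorem exists_mulEquiv (h : IsUniform B) :
    ∃ φ : B ≃* StructureSemilattice B × Rect h.Row h.op.Row, ∀ b, (φ b).1 = cls b := by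
  let F : B → StructureSemilattice B × Rect h.Row h.op.Row := fun e =>
    (cls e, ⟨h.row e, h.op.row (.op e)⟩)
  have hF : ∀ e f, F (e * f) = F e * F f := fun e f =>
    Prod.ext (cls_mul e f) (Rect.ext (h.row_mul e f) (h.op.row_mul (.op f) (.op e)))
  have hbij : Function.Bijective F := by
    constructor
    · intro e f hef
      have hd : DRel e f := (cls_eq_iff e f).1 (congrArg Prod.fst hef)
      have h₁ : SameRow e f := h.row_eq_iff.1 (congrArg (fun p => p.2.row) hef)
      have h₂ : SameRow (.op e : Bᵐᵒᵖ) (.op f) :=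
        h.op.row_eq_iff.1 (congrArg (fun p => p.2.col) hef)
      have k₁ := (sameRow_of_below hd.below).1 h₁
      have k₂ : e * f = e :=
        MulOpposite.op_injective ((sameRow_of_below (below_op.2 hd.below)).1 h₂)
      have k₃ : f * e * f = f := hd.2
      rw [k₁, k₂] at k₃
      exact k₃
    · rintro ⟨y, ⟨r, c⟩⟩
      obtain ⟨y, rfl⟩ : ∃ b : B, cls b = y := by
        obtain ⟨b⟩ := y
        exact ⟨b, rfl⟩
      obtain ⟨e, rfl⟩ : ∃ e, h.row e = r := Quotient.exists_rep r
      obtain ⟨f, rfl⟩ : ∃ f, h.op.row f = c := Quotient.exists_rep c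
      obtain ⟨u, hu, hur⟩ := h.exists_row_eq e y
      obtain ⟨v, hv, hvr⟩ := h.op.exists_row_eq f (.op y)
      have hv := (cls_eq_iff _ _).2 (dRel_op.1 hv)
      have hu := (cls_eq_iff _ _).2 hu
      refine ⟨u * v.unop, Prod.ext ?_ (Rect.ext ?_ ?_)⟩
      · change cls (u * v.unop) = cls y
        rw [cls_mul, hu, hv]
        exact mul_self _
      · exact (h.row_mul u v.unop).trans hur
      · exact (h.op.row_mul v (.op u)).trans hvr
  exact ⟨MulEquiv.mk (Equiv.ofBijective F hbij) hF, fun _ => rfl⟩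

end IsUniform

theorem isUniform_of_not_belowTotal (hB : IsStructureHomogeneous B) (hl : ¬ BelowTotal B) :
    IsUniform B := by
  have hK := hB.isClassHomogeneous
  have hU : ∀ u x y : B, Under x u → Under y u → DRel x y → x = y :=
    fun u x y h k hd => under_unique hB.1 hK hl h k hd
  exact ⟨fun h k hd => hU _ _ _ h k hd, fun h k hd => eq_of_under hB.1 hK hU h k hd,
    fun h => hK.exists_above h⟩

theorem exists_equiv_index (X : Type u) [Countable X] [Nonempty X] :
    ∃ n : ℕ∞, 1 ≤ n ∧ Nonempty (X ≃ Index n) := by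
  rcases finite_or_infinite X with hX | hX
  · obtain ⟨n, ⟨e⟩⟩ := Finite.exists_equiv_fin X
    refine ⟨(n : ℕ∞), ?_, ⟨e⟩⟩
    have : 0 < n := Fin.pos (e (Classical.arbitrary X))
    exact_mod_cast this
  · exact ⟨⊤, le_top, nonempty_equiv_of_countable (α := X) (β := ℕ)⟩

/-- Relabelling rows and columns. -/
def prodRectCongr {Y : Type u} [Band Y] {I J : Type u} {I' J' : Type} (a : I ≃ I') (b : J ≃ J') :
    Y × Rect I J ≃* Y × Rect I' J' where
  toFun p := (p.1, ⟨a p.2.row, b p.2.col⟩)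
  invFun p := (p.1, ⟨a.symm p.2.row, b.symm p.2.col⟩)
  left_inv p := by simp
  right_inv p := by simp
  map_mul' _ _ := rfl

/-- A semilattice automorphism of the first factor is read off from an automorphism of the band that
extends a map between copies of finite subsemilattices in one slice. -/
theorem isHomogeneous_structureSemilattice {I J : Type u}
    (φ : B ≃* StructureSemilattice B × Rect I J)
    (hφ : ∀ b, (φ b).1 = cls b) (i : I) (j : J) (hB : IsHomogeneous B) :
    IsHomogeneous (StructureSemilattice B) := by
  refine IsHomogeneous.of_realizes fun n m f g hf hg => ?_
  let s : StructureSemilattice B → B := fun y => φ.symm (y, ⟨i, j⟩)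
  have hs : ∀ y, cls (s y) = y := fun y => by rw [← hφ]; simp [s]
  have hsm : ∀ y z, s y * s z = s (y * z) := fun y z => by
    simp only [s]
    rw [← map_mul]
    rfl
  have hsi : Function.Injective s := fun y z h => by rw [← hs y, h, hs]
  obtain ⟨Φ, hΦ⟩ := hB.exists_mulEquiv (m := m) (f := fun k => s (f k)) (g := fun k => s (g k))
    ⟨hsi.comp hf.inj, fun k l => by rw [hsm, hf.mul]⟩
    ⟨hsi.comp hg.inj, fun k l => by rw [hsm, hg.mul]⟩
  let ψ : StructureSemilattice B ≃* StructureSemilattice B :=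
    Con.congr Φ (Con.ext fun x y =>
      ⟨fun h => DRel.map Φ h, fun h => by
        have h' := DRel.map Φ.symm (e := Φ x) (f := Φ y) h
        rwa [MulEquiv.symm_apply_apply, MulEquiv.symm_apply_apply] at h'⟩)
  have hψ : ∀ b, ψ (cls b) = cls (Φ b) := fun _ => rfl
  exact ⟨ψ, fun k => by rw [← hs (f k), hψ, hΦ, hs]⟩

end NonLinear
end Band

theorem mainTheorem4 (B : Type u) [Band B] [Countable B] :
    Band.IsStructureHomogeneous B ↔
      (∃ (C : Type u) (_ : Band C),
        Band.IsHomogeneous C ∧ Band.IsLinearlyOrdered C ∧ Nonempty (B ≃* C)) ∨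
      (∃ (Y : Type u) (_ : Band Y) (n m : ℕ∞),
        Band.IsSemilattice Y ∧ Band.IsHomogeneous Y ∧ 1 ≤ n ∧ 1 ≤ m ∧
          Nonempty (B ≃* Y × Band.RectNM n m)) := by
  constructor
  · intro hB
    by_cases hl : Band.IsLinearlyOrdered B
    · exact Or.inl ⟨B, inferInstance, hB.1, hl, ⟨MulEquiv.refl B⟩⟩
    right
    rw [Band.below_total_iff] at hl
    have hU := Band.isUniform_of_not_belowTotal hB hl
    have hne : Nonempty B := by
      by_contra h
      exact hl fun e => (h ⟨e⟩).elim
    obtain ⟨b⟩ := hne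
    have : Nonempty hU.Row := ⟨hU.row b⟩
    have : Nonempty hU.op.Row := ⟨hU.op.row (.op b)⟩
    have : Countable Bᵐᵒᵖ := MulOpposite.unop_injective.countable
    obtain ⟨φ, hφ⟩ := hU.exists_mulEquiv
    obtain ⟨n, hn, ⟨a⟩⟩ := Band.exists_equiv_index hU.Row
    obtain ⟨m, hm, ⟨c⟩⟩ := Band.exists_equiv_index hU.op.Row
    exact ⟨Band.StructureSemilattice B, inferInstance, n, m,
      Band.structureSemilattice_isSemilattice B,
      Band.isHomogeneous_structureSemilattice φ hφ (hU.row b) (hU.op.row (.op b)) hB.1, hn, hm,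
      ⟨φ.trans (Band.prodRectCongr a c)⟩⟩
  · rintro (⟨C, _, hC, hl, ⟨e⟩⟩ | ⟨Y, _, n, m, hY, hYh, hn, hm, ⟨φ⟩⟩)
    · refine (hC.congr e).isStructureHomogeneous fun x y => ?_
      have hmap : ∀ a b : B, Band.Below (e a) (e b) ↔ Band.Below a b := fun a b => by
        unfold Band.Below
        rw [← map_mul, ← map_mul, e.injective.eq_iff]
      rw [← hmap, ← hmap]
      exact Band.below_total_iff.1 hl _ _
    · have := Band.nonempty_index hn
      have := Band.nonempty_index hm
      exact Band.isStructureHomogeneous_of_product φ hY hYh
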